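/- Let $p,q\in\mathbb C$ with $|p|<1$ and $0<|q|<1$. Write $(a;q)_\infty=\prod_{k\ge 0}(1-aq^k)$, $\theta(z)=\theta(z;p)=(z;p)_\infty(p/z;p)_\infty$ and, for a non-negative integer $m$, $(a)_m=(a;q,p)_m=\prod_{j=0}^{m-1}\theta(aq^j;p)$, with $(a_1,\dots,a_k)_m=(a_1)_m\cdots(a_k)_m$. Let $n$ and $N_1,\dots,N_n$ be non-negative integers, let $s_1,\dots,s_{n+3}\in\mathbb C\setminus\{0\}$, and put $S=s_1\cdots s_{n+3}$, $S'=s_1\cdots s_n$. For $\lambda=(\lambda_1,\dots,\lambda_n)$ put $|\lambda|=\lambda_1+\cdots+\lambda_n$. If none of the denominators in the summands below vanishes, then \begin{align*} \sum_{\lambda}\prod_{i=1}^n&\frac{\theta(S's_iq^{\lambda_i+|\lambda|})}{\theta(S's_i)} \prod_{1\leq i<j\leq n} \frac{\theta(q^{\lambda_i-\lambda_j}s_is_j^{-1})}{\theta(s_is_j^{-1})} \frac{1}{(qS^{-1}s_is_j)_{\lambda_i+\lambda_j}} \\ &\times\prod_{j=1}^{n+3} \frac{(S's_j)_{|\lambda|}}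 {\prod_{i=1}^n(qs_is_j^{-1})_{\lambda_i}} \prod_{i,j=1}^n (q^{-N_j}s_is_j^{-1},q^{N_j+1}S^{-1}s_is_j)_{\lambda_i} \\ &\times \prod_{i=1}^n \frac{(SS's_i^{-1})_{|\lambda|-\lambda_i} \, q^{i\lambda_i}} {(q^{-N_i}SS's_i^{-1},q^{N_i+1}S's_i)_{|\lambda|}} \\ &=\prod_{i=1}^n\biggl( \frac{(qS's_i)_{N_i}}{(qS^{-1}S'^{-1}s_i)_{N_i}} \prod_{j=n+1}^{n+3} \frac{(qS^{-1}s_is_j)_{N_i}}{(qs_is_j^{-1})_{N_i}} \biggr), \end{align*} where the sum is over all $\lambda=(\lambda_1,\dots,\lambda_n)$ of integers with $0\leq\lambda_i\leq N_i$ for all $i\in\{1,\dots,n\}$. (The denominators on the right-hand side are then nonzero as well.) -/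

import Mathlib

open scoped BigOperators

/-- The infinite shifted factorial `(a; q)_∞ = ∏_{k ≥ 0} (1 - a q^k)`. -/
noncomputable def qPochInf (a q : ℂ) : ℂ := ∏' k : ℕ, (1 - a * q ^ k)

/-- For `|q| < 1` the product defining `(a; q)_∞` converges (so it is not a junk value). -/
theorem qPochInf_multipliable (a : ℂ) {q : ℂ} (hq : ‖q‖ < 1) :
    Multipliable fun k : ℕ => 1 - a * q ^ k := by
  have h : Summable fun k : ℕ => ‖-(a * q ^ k)‖ := by
    simpa [norm_mul, norm_pow] using
      (summable_geometric_of_lt_one (norm_nonneg q) hq).mul_left ‖a‖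
  simpa [sub_eq_add_neg] using multipliable_one_add_of_summable h

/-- The theta function `θ(z; p) = (z, p/z; p)_∞`. For `p = 0` it is `1 - z`. -/
noncomputable def ellTheta (z p : ℂ) : ℂ := qPochInf z p * qPochInf (p / z) p

/-- The elliptic shifted factorial `(a; q, p)_m = ∏_{j=0}^{m-1} θ(a q^j; p)`
for a non-negative integer `m`. -/
noncomputable def ellFac (a q p : ℂ) (m : ℕ) : ℂ :=
  ∏ j ∈ Finset.range m, ellTheta (a * q ^ j) p

/-- The product `S = s_1 ⋯ s_{n+3}` of all parameters. -/
noncomputable def prodAll {n : ℕ} (s : Fin (n + 3) → ℂ) : ℂ := ∏ j, s j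

/-- The product `S' = s_1 ⋯ s_n` of the first `n` parameters
(`Fin.castAdd 3` embeds the indices `1, …, n` into `1, …, n + 3`). -/
noncomputable def prodFirst {n : ℕ} (s : Fin (n + 3) → ℂ) : ℂ :=
  ∏ i : Fin n, s (Fin.castAdd 3 i)

/-- The summand indexed by `l = (λ_1, …, λ_n)`. Indices in `Fin n` start at `0`, so the
exponent `i λ_i` reads `(i + 1) * l i`. The difference `|λ| - λ_i` is
an honest natural number since `λ_i ≤ |λ|`. -/
noncomputable def sumTerm {n : ℕ} (p q : ℂ) (s : Fin (n + 3) → ℂ) (N l : Fin n → ℕ) : ℂ :=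
  let S := prodAll s
  let S' := prodFirst s
  let x : Fin n → ℂ := fun i => s (Fin.castAdd 3 i)
  let L : ℕ := ∑ i, l i
  (∏ i : Fin n, ellTheta (S' * x i * q ^ (l i + L)) p / ellTheta (S' * x i) p)
  * (∏ i : Fin n, ∏ j ∈ Finset.Ioi i,
      ellTheta (q ^ ((l i : ℤ) - (l j : ℤ)) * x i / x j) p / ellTheta (x i / x j) p
        * (1 / ellFac (q * S⁻¹ * x i * x j) q p (l i + l j)))
  * (∏ j : Fin (n + 3),
      ellFac (S' * s j) q p L / ∏ i : Fin n, ellFac (q * x i / s j) q p (l i))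
  * (∏ i : Fin n, ∏ j : Fin n,
      ellFac (q ^ (-(N j : ℤ)) * x i / x j) q p (l i)
        * ellFac (q ^ (N j + 1) * S⁻¹ * x i * x j) q p (l i))
  * (∏ i : Fin n,
      ellFac (S * S' / x i) q p (L - l i) * q ^ (((i : ℕ) + 1) * l i)
        / (ellFac (q ^ (-(N i : ℤ)) * S * S' / x i) q p L
            * ellFac (q ^ (N i + 1) * S' * x i) q p L))

/-- The closed form of the sum; `Fin.natAdd n` embeds three indices as `n+1, n+2, n+3`. -/
noncomputable def sumValue {n : ℕ} (p q : ℂ) (s : Fin (n + 3) → ℂ) (N : Fin n → ℕ) : ℂ :=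
  let S := prodAll s
  let S' := prodFirst s
  let x : Fin n → ℂ := fun i => s (Fin.castAdd 3 i)
  ∏ i : Fin n,
    (ellFac (q * S' * x i) q p (N i) / ellFac (q * S⁻¹ * S'⁻¹ * x i) q p (N i)
      * ∏ k : Fin 3,
          ellFac (q * S⁻¹ * x i * s (Fin.natAdd n k)) q p (N i)
            / ellFac (q * x i / s (Fin.natAdd n k)) q p (N i))

open Filter Topology

/-! Write X for the product of the first n parameters x_i and a, b, c for the last three, so that S
= Xabc. The proof is an induction on |N| = N_1 + ⋯ + N_n by interpolation in a, with b, S and the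
x_i, hence also K = ac, held fixed. Put a = κα and c = κ/α with κ² = K. After multiplication by the
denominators (qx_i/a)_{N_i} and (qx_i/c)_{N_i}, α enters only through products θ(wα)θ(w/α). The
addition formula in the form θ(xy)θ(x/y) = x(F₁(x)F₀(y) − F₀(x)F₁(y)) makes each of these linear in
(F₀(α), F₁(α)). Both sides are therefore binary forms of degree |N| in that vector
(`isThetaForm_clearedSum`, `isThetaForm_clearedValue`), and it suffices to compare them at |N| + 1
pairwise non-proportional vectors (`IsBinaryForm.eq_zero`).

One point is a = 1/X, where (Xa)_{|λ|} kills every term but λ = 0 (`clearedSum_base`). The others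
are a = q^m x_r with 1 ≤ m ≤ N_r. There the terms with λ_r < m vanish, and replacing λ_r by λ_r + m
turns the rest into the sum with N_r lowered by m, x_r replaced by q^m x_r and a by x_r. The product
S is unchanged, so the induction hypothesis applies (`clearedSum_shift`); that the prefactors match
is the product identity `jacksonValue_shift`.

Non-proportionality of the points and admissibility of the shifted parameters hold for generic
parameters (`jacksonSum_generic`). In general the parameters are deformed by powers of e^t: only
countably many t are bad, and both sides are continuous at t = 0 (`jacksonSum`). The addition
formula comes from multiplying two Jacobi triple product series and sorting the double sum by
parity. -/

/-! ### Zeros and continuity of the theta function -/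

theorem qPochInf_eq_zero {a p : ℂ} (hp : ‖p‖ < 1) (h : qPochInf a p = 0) :
    ∃ k : ℕ, a * p ^ k = 1 := by
  by_contra! hne
  have hs : Summable fun k : ℕ => ‖-(a * p ^ k)‖ := by
    simpa [norm_mul, norm_pow] using
      (summable_geometric_of_lt_one (norm_nonneg p) hp).mul_left ‖a‖
  refine tprod_one_add_ne_zero_of_summable (f := fun k : ℕ => -(a * p ^ k)) ?_ hs ?_
  · intro k hk
    exact hne k (by linear_combination -hk)
  · simpa [qPochInf, sub_eq_add_neg] using h

theorem qPochInf_eq_mul {a p : ℂ} (hp : ‖p‖ < 1) :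
    qPochInf a p = (1 - a) * qPochInf (p * a) p := by
  have hfun : (fun k : ℕ => 1 - a * p ^ (k + 1)) = fun k : ℕ => 1 - p * a * p ^ k := by
    funext k
    ring
  have hm : Multipliable fun k : ℕ => 1 - a * p ^ (k + 1) :=
    hfun ▸ qPochInf_multipliable (p * a) hp
  have h := tprod_eq_zero_mul' (f := fun k : ℕ => 1 - a * p ^ k) hm
  rw [hfun] at h
  rw [qPochInf, qPochInf, h, pow_zero, mul_one]

/-- On a closed ball the factors are dominated by a geometric series, so the partial products
converge uniformly there. -/
theorem continuous_qPochInf {p : ℂ} (hp : ‖p‖ < 1) : Continuous fun a => qPochInf a p := by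
  rw [continuous_iff_continuousAt]
  intro a₀
  have hsum : Summable fun k : ℕ => (‖a₀‖ + 1) * ‖p‖ ^ k :=
    (summable_geometric_of_lt_one (norm_nonneg p) hp).mul_left _
  have hunif := Summable.hasProdUniformlyOn_nat_one_add (R := ℂ)
    (f := fun (k : ℕ) (a : ℂ) => -(a * p ^ k))
    (isCompact_closedBall (0 : ℂ) (‖a₀‖ + 1)) hsum
    (Eventually.of_forall fun k a ha => by
      rw [norm_neg, norm_mul, norm_pow]
      gcongr
      simpa using ha)
    (fun k => by fun_prop)
  have hc : ContinuousOn (fun a => qPochInf a p) (Metric.closedBall (0 : ℂ) (‖a₀‖ + 1)) := by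
    have := hunif.tendstoUniformlyOn_finsetRange.continuousOn
      (Frequently.of_forall fun n => by
        fun_prop)
    simpa [qPochInf, sub_eq_add_neg] using this
  refine hc.continuousAt (mem_of_superset
    (Metric.isOpen_ball.mem_nhds (x := a₀) (s := Metric.ball (0 : ℂ) (‖a₀‖ + 1)) ?_)
    Metric.ball_subset_closedBall)
  simp

theorem ellTheta_one {p : ℂ} (hp : ‖p‖ < 1) : ellTheta 1 p = 0 := by
  rw [ellTheta, qPochInf_eq_mul hp]
  simp

theorem ellTheta_inv {z p : ℂ} (hp : ‖p‖ < 1) (hz : z ≠ 0) :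
    ellTheta z⁻¹ p = -z⁻¹ * ellTheta z p := by
  rw [ellTheta, ellTheta, qPochInf_eq_mul hp (a := z⁻¹), qPochInf_eq_mul hp (a := z)]
  rw [div_inv_eq_mul, div_eq_mul_inv]
  field_simp
  ring

theorem continuousAt_ellTheta {z p : ℂ} (hp : ‖p‖ < 1) (hz : z ≠ 0) :
    ContinuousAt (fun z => ellTheta z p) z := by
  unfold ellTheta
  have h1 := (continuous_qPochInf hp).continuousAt (x := z)
  have h2 : ContinuousAt (fun z : ℂ => p / z) z := continuousAt_const.div continuousAt_id hz
  exact h1.mul ((continuous_qPochInf hp).continuousAt.comp h2)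

/-- The zeros lie among the powers of p. Countability is all that the final genericity argument
needs. -/
theorem countable_ellTheta_zero {p : ℂ} (hp : ‖p‖ < 1) :
    {z : ℂ | z ≠ 0 ∧ ellTheta z p = 0}.Countable := by
  refine ((Set.countable_range fun k : ℕ => (p ^ k)⁻¹).union
    (Set.countable_range fun k : ℕ => p * p ^ k)).mono ?_
  rintro z ⟨hz, h⟩
  rcases mul_eq_zero.mp h with h | h
  · obtain ⟨k, hk⟩ := qPochInf_eq_zero hp h
    exact Or.inl ⟨k, (eq_inv_of_mul_eq_one_left hk).symm⟩
  · obtain ⟨k, hk⟩ := qPochInf_eq_zero hp h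
    refine Or.inr ⟨k, ?_⟩
    field_simp at hk
    exact hk

/-! ### The Jacobi triple product -/

theorem tendsto_prod_qPochInf (a : ℂ) {p : ℂ} (hp : ‖p‖ < 1) :
    Tendsto (fun m : ℕ => ∏ k ∈ Finset.range m, (1 - a * p ^ k)) atTop (𝓝 (qPochInf a p)) :=
  (qPochInf_multipliable a hp).hasProd.tendsto_prod_nat

/-- The finite product `(p; p)_m`. -/
noncomputable def eulerProd (p : ℂ) (m : ℕ) : ℂ := ∏ i ∈ Finset.range m, (1 - p * p ^ i)

theorem eulerProd_succ (p : ℂ) (m : ℕ) :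
    eulerProd p (m + 1) = eulerProd p m * (1 - p ^ (m + 1)) := by
  rw [eulerProd, Finset.prod_range_succ, ← eulerProd, pow_succ']

theorem one_sub_pow_ne_zero {p : ℂ} (hp : ‖p‖ < 1) (m : ℕ) : 1 - p ^ (m + 1) ≠ 0 := by
  intro h
  have h1 : ‖p ^ (m + 1)‖ < 1 := by
    rw [norm_pow]
    exact pow_lt_one₀ (norm_nonneg _) hp (by omega)
  rw [← sub_eq_zero.mp h] at h1
  simp at h1

theorem eulerProd_ne_zero {p : ℂ} (hp : ‖p‖ < 1) (m : ℕ) : eulerProd p m ≠ 0 := by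
  refine Finset.prod_ne_zero_iff.mpr fun i _ => ?_
  rw [← pow_succ']
  exact one_sub_pow_ne_zero hp i

theorem qPochInf_self_ne_zero {p : ℂ} (hp : ‖p‖ < 1) : qPochInf p p ≠ 0 := by
  intro h
  obtain ⟨k, hk⟩ := qPochInf_eq_zero hp h
  rw [← pow_succ'] at hk
  exact one_sub_pow_ne_zero hp k (by rw [hk, sub_self])

theorem q_binomial {p : ℂ} (hp : ‖p‖ < 1) (x : ℂ) (N : ℕ) :
    ∏ k ∈ Finset.range N, (1 + x * p ^ k) =
      ∑ k ∈ Finset.range (N + 1), eulerProd p N / (eulerProd p k * eulerProd p (N - k)) *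
        ∏ i ∈ Finset.range k, (x * p ^ i) := by
  induction N with
  | zero => simp [eulerProd]
  | succ N ih =>
    have h0 : ∀ m, eulerProd p m ≠ 0 := eulerProd_ne_zero hp
    have e0 : eulerProd p 0 = 1 := by simp [eulerProd]
    rw [Finset.prod_range_succ, ih]
    set u : ℕ → ℂ := fun k => ∏ i ∈ Finset.range k, (x * p ^ i) with hu
    have hu1 : ∀ k, u (k + 1) = u k * (x * p ^ k) := fun k => by
      simp [hu, Finset.prod_range_succ]
    rw [mul_add, mul_one]
    conv_lhs => enter [1]; rw [Finset.sum_range_succ']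
    conv_lhs => enter [2, 1]; rw [Finset.sum_range_succ]
    conv_rhs => rw [Finset.sum_range_succ', Finset.sum_range_succ]
    rw [add_mul, Finset.sum_mul]
    -- This is the q-Pascal rule [N+1, k+1] = [N, k+1] + p^{N-k} [N, k]; the factor p^{N-k} joins
    -- the p^k of the last factor of `u (k + 1)` to give p^N.
    have hterm : ∀ k ∈ Finset.range N,
        eulerProd p (N + 1) / (eulerProd p (k + 1) * eulerProd p (N + 1 - (k + 1))) * u (k + 1)
        = eulerProd p N / (eulerProd p (k + 1) * eulerProd p (N - (k + 1))) * u (k + 1)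
          + eulerProd p N / (eulerProd p k * eulerProd p (N - k)) * u k * (x * p ^ N) := by
      intro k hk
      obtain ⟨d, rfl⟩ : ∃ d, N = k + 1 + d := ⟨N - (k + 1), by
        have := Finset.mem_range.mp hk; omega⟩
      have e1 : k + 1 + d + 1 - (k + 1) = d + 1 := by omega
      have e2 : k + 1 + d - (k + 1) = d := by omega
      have e3 : k + 1 + d - k = d + 1 := by omega
      rw [e1, e2, e3, hu1, eulerProd_succ p (k + 1 + d), eulerProd_succ p k, eulerProd_succ p d]
      have := h0 k
      have := h0 d
      have := one_sub_pow_ne_zero hp k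
      have := one_sub_pow_ne_zero hp d
      field_simp
      ring
    rw [Finset.sum_congr rfl hterm, Finset.sum_add_distrib]
    simp only [Nat.sub_zero, e0, Nat.sub_self, one_mul, mul_one, div_self (h0 _), hu]
    rw [Finset.prod_range_succ _ N]
    ring

/-- The general term `(-z)^j p^{j(j-1)/2}` of the theta series. -/
noncomputable def thetaTerm (p z : ℂ) (j : ℤ) : ℂ := (-z) ^ j * p ^ (j * (j - 1) / 2)

theorem thetaTerm_add_one {p z : ℂ} (hp0 : p ≠ 0) (hz : z ≠ 0) (j : ℤ) :
    thetaTerm p z (j + 1) = thetaTerm p z j * (-z * p ^ j) := by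
  have e : (j + 1) * (j + 1 - 1) / 2 = j * (j - 1) / 2 + j := by
    have : (j + 1) * (j + 1 - 1) = j * (j - 1) + j * 2 := by ring
    rw [this, Int.add_mul_ediv_right _ _ (by norm_num)]
  rw [thetaTerm, thetaTerm, e, zpow_add₀ hp0, zpow_add₀ (neg_ne_zero.mpr hz), zpow_one]
  ring

theorem prod_mul_thetaTerm {p z : ℂ} (hp0 : p ≠ 0) (hz : z ≠ 0) (m : ℕ) :
    (∏ k ∈ Finset.range m, (1 - z * p ^ (-(k + 1 : ℤ)))) * thetaTerm p z (-m) =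
      ∏ k ∈ Finset.range m, (1 - p / z * p ^ k) := by
  induction m with
  | zero => simp [thetaTerm]
  | succ m ih =>
    rw [Finset.prod_range_succ, Finset.prod_range_succ, ← ih]
    have h := thetaTerm_add_one hp0 hz (-((m : ℤ) + 1))
    rw [show -((m : ℤ) + 1) + 1 = -m by ring] at h
    push_cast
    rw [h]
    have h2 : p ^ (-((m : ℤ) + 1)) * (p / z * p ^ m) = 1 / z := by
      rw [zpow_neg, zpow_add₀ hp0, zpow_natCast, zpow_one]
      field_simp
    have : (1 - z * p ^ (-((m : ℤ) + 1))) =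
        (-z * p ^ (-((m : ℤ) + 1))) * (1 - p / z * p ^ m) := by
      rw [mul_sub, mul_assoc (-z) _ (p / z * p ^ m), h2]
      field_simp
      ring
    rw [this]
    ring

theorem thetaTerm_shift {p z : ℂ} (hp0 : p ≠ 0) (hz : z ≠ 0) (m k : ℕ) :
    thetaTerm p z (-m) * ∏ i ∈ Finset.range k, (-z * p ^ (-m : ℤ) * p ^ i) =
      thetaTerm p z (k - m) := by
  induction k with
  | zero => simp
  | succ k ih =>
    rw [Finset.prod_range_succ, ← mul_assoc, ih]
    push_cast
    rw [show (k : ℤ) + 1 - m = (k - m) + 1 by ring, thetaTerm_add_one hp0 hz, zpow_sub₀ hp0,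
      zpow_neg, zpow_natCast, zpow_natCast]
    ring

/-- Apply the q-binomial theorem to 2m factors starting at -zp^{-m}. The m factors with negative
powers of p turn into those of (p/z; p)_m once each is flipped, and the flipping monomials make up
the theta term of index -m. -/
theorem finite_triple_product {p z : ℂ} (hp : ‖p‖ < 1) (hp0 : p ≠ 0) (hz : z ≠ 0) (m : ℕ) :
    (∏ k ∈ Finset.range m, (1 - z * p ^ k)) * ∏ k ∈ Finset.range m, (1 - p / z * p ^ k) =
      ∑ k ∈ Finset.range (2 * m + 1), eulerProd p (2 * m) /
        (eulerProd p k * eulerProd p (2 * m - k)) * thetaTerm p z (k - m) := by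
  have h := q_binomial hp (-z * p ^ (-m : ℤ)) (2 * m)
  have hsplit : ∏ k ∈ Finset.range (2 * m), (1 + -z * p ^ (-m : ℤ) * p ^ k) =
      (∏ k ∈ Finset.range m, (1 - z * p ^ (-(k + 1 : ℤ)))) *
        ∏ k ∈ Finset.range m, (1 - z * p ^ k) := by
    rw [two_mul, Finset.prod_range_add]
    congr 1
    · rw [← Finset.prod_range_reflect]
      refine Finset.prod_congr rfl fun k hk => ?_
      have hk' := Finset.mem_range.mp hk
      rw [mul_assoc, ← zpow_natCast, ← zpow_add₀ hp0]
      have : -(m : ℤ) + ((m - 1 - k : ℕ) : ℤ) = -(k + 1) := by omega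
      rw [this]
      ring
    · refine Finset.prod_congr rfl fun k _ => ?_
      rw [mul_assoc, ← zpow_natCast, ← zpow_add₀ hp0]
      have : -(m : ℤ) + ((m + k : ℕ) : ℤ) = k := by push_cast; ring
      rw [this, zpow_natCast]
      ring
  rw [hsplit] at h
  rw [← prod_mul_thetaTerm hp0 hz m, mul_left_comm, mul_comm _ (thetaTerm p z _),
    mul_left_comm, h, Finset.mul_sum]
  refine Finset.sum_congr rfl fun k _ => ?_
  rw [← thetaTerm_shift hp0 hz m k]
  ring

/-- The finite products and their inverses converge, as the limit is nonzero, hence are bounded. The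
constant dominates all the q-binomial coefficients when m tends to infinity. -/
theorem exists_eulerProd_bound {p : ℂ} (hp : ‖p‖ < 1) :
    ∃ C : ℝ, 0 ≤ C ∧ ∀ a b c,
      ‖eulerProd p a / (eulerProd p b * eulerProd p c)‖ ≤ C := by
  have ht : Tendsto (eulerProd p) atTop (𝓝 (qPochInf p p)) := tendsto_prod_qPochInf p hp
  obtain ⟨C₁, h₁⟩ := (Metric.isBounded_range_of_tendsto _ ht).exists_norm_le
  obtain ⟨C₂, h₂⟩ := (Metric.isBounded_range_of_tendsto _
    (ht.inv₀ (qPochInf_self_ne_zero hp))).exists_norm_le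
  have h₁' : ∀ a, ‖eulerProd p a‖ ≤ C₁ := fun a => h₁ _ ⟨a, rfl⟩
  have h₂' : ∀ a, ‖(eulerProd p a)⁻¹‖ ≤ C₂ := fun a => h₂ _ ⟨a, rfl⟩
  have p₁ : 0 ≤ C₁ := (norm_nonneg _).trans (h₁' 0)
  have p₂ : 0 ≤ C₂ := (norm_nonneg _).trans (h₂' 0)
  refine ⟨C₁ * (C₂ * C₂), by positivity, fun a b c => ?_⟩
  rw [div_eq_mul_inv, mul_inv, norm_mul, norm_mul]
  exact mul_le_mul (h₁' a) (mul_le_mul (h₂' b) (h₂' c) (norm_nonneg _) p₂) (by positivity) p₁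

/-- With p = e^{2πiτ} and -z = e^{2πiv} this is the series of `jacobiTheta₂` at v - τ/2, and |p| < 1
says that τ lies in the upper half-plane. -/
theorem summable_thetaTerm {p z : ℂ} (hp : ‖p‖ < 1) (hp0 : p ≠ 0) (hz : z ≠ 0) :
    Summable (thetaTerm p z) := by
  have hpi : (2 * Real.pi * Complex.I : ℂ) ≠ 0 := Complex.two_pi_I_ne_zero
  set τ : ℂ := Complex.log p / (2 * Real.pi * Complex.I) with hτ
  set v : ℂ := Complex.log (-z) / (2 * Real.pi * Complex.I) with hv
  have hpe : p = Complex.exp (2 * Real.pi * Complex.I * τ) := by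
    rw [hτ, mul_div_cancel₀ _ hpi, Complex.exp_log hp0]
  have hze : -z = Complex.exp (2 * Real.pi * Complex.I * v) := by
    rw [hv, mul_div_cancel₀ _ hpi, Complex.exp_log (neg_ne_zero.mpr hz)]
  have him : 0 < τ.im := by
    have h1 : ‖p‖ = Real.exp (-(2 * Real.pi * τ.im)) := by
      conv_lhs => rw [hpe]
      rw [Complex.norm_exp]
      congr 1
      simp
    rw [h1, Real.exp_lt_one_iff] at hp
    have := Real.pi_pos
    by_contra! hc
    nlinarith
  refine ((summable_jacobiTheta₂_term_iff (v - τ / 2) τ).mpr him).congr fun j => ?_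
  rw [thetaTerm, jacobiTheta₂_term, hpe, hze, ← Complex.exp_int_mul, ← Complex.exp_int_mul,
    ← Complex.exp_add]
  congr 1
  have he : ((j * (j - 1) / 2 : ℤ) : ℂ) = (j : ℂ) * (j - 1) / 2 := by
    rw [Int.cast_div (Int.even_mul_pred_self j).two_dvd (by norm_num)]
    push_cast
    ring
  rw [he]
  ring

/-- Jacobi's triple product identity. -/
theorem ellTheta_triple_product {p z : ℂ} (hp : ‖p‖ < 1) (hp0 : p ≠ 0) (hz : z ≠ 0) :
    qPochInf p p * ellTheta z p = ∑' j : ℤ, thetaTerm p z j := by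
  have hE0 := qPochInf_self_ne_zero hp
  have hE : Tendsto (eulerProd p) atTop (𝓝 (qPochInf p p)) := tendsto_prod_qPochInf p hp
  obtain ⟨C, hC0, hC⟩ := exists_eulerProd_bound hp
  -- The m-th finite identity, recentred and extended by zero to all of ℤ, so that dominated
  -- convergence applies term by term.
  let f : ℕ → ℤ → ℂ := fun m j => if j ∈ Finset.Icc (-(m : ℤ)) m then
    eulerProd p (2 * m) / (eulerProd p (j + m).toNat * eulerProd p (2 * m - (j + m).toNat)) *
      thetaTerm p z j else 0
  have hsum : ∀ m, ∑' j, f m j =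
      (∏ k ∈ Finset.range m, (1 - z * p ^ k)) * ∏ k ∈ Finset.range m, (1 - p / z * p ^ k) := by
    intro m
    rw [finite_triple_product hp hp0 hz, tsum_eq_sum (s := Finset.Icc (-(m : ℤ)) m)
      (fun j hj => if_neg hj)]
    symm
    refine Finset.sum_bij' (fun k _ => (k : ℤ) - m) (fun j _ => (j + m).toNat) ?_ ?_ ?_ ?_ ?_
    · intro k hk
      simp only [Finset.mem_range, Finset.mem_Icc] at hk ⊢
      omega
    · intro j hj
      simp only [Finset.mem_range, Finset.mem_Icc] at hj ⊢
      omega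
    · intro k hk
      simp
    · intro j hj
      simp only [Finset.mem_Icc] at hj
      omega
    · intro k hk
      have hk' : (k : ℤ) - m ∈ Finset.Icc (-(m : ℤ)) m := by
        simp only [Finset.mem_range, Finset.mem_Icc] at hk ⊢
        omega
      simp only [if_pos hk']
      simp
  have hlim : Tendsto (fun m => ∑' j, f m j) atTop
      (𝓝 (∑' j : ℤ, (qPochInf p p)⁻¹ * thetaTerm p z j)) := by
    refine tendsto_tsum_of_dominated_convergence
      (bound := fun j => C * ‖thetaTerm p z j‖)
      ((summable_thetaTerm hp hp0 hz).norm.mul_left C) ?_ ?_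
    · intro j
      have h1 : Tendsto (fun m : ℕ => 2 * m) atTop atTop :=
        tendsto_atTop_mono (fun m => Nat.le_mul_of_pos_left m two_pos) tendsto_id
      have h2 : Tendsto (fun m : ℕ => (j + m).toNat) atTop atTop :=
        tendsto_atTop.mpr fun b => by
          filter_upwards [eventually_ge_atTop (b + j.natAbs)] with m hm
          omega
      have h3 : Tendsto (fun m : ℕ => 2 * m - (j + m).toNat) atTop atTop :=
        tendsto_atTop.mpr fun b => by
          filter_upwards [eventually_ge_atTop (b + j.natAbs)] with m hm
          omega
      have h4 := ((hE.comp h1).div ((hE.comp h2).mul (hE.comp h3))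
        (mul_ne_zero hE0 hE0)).mul_const (thetaTerm p z j)
      have e : qPochInf p p / (qPochInf p p * qPochInf p p) = (qPochInf p p)⁻¹ := by
        field_simp
      rw [e] at h4
      refine h4.congr' ?_
      filter_upwards [eventually_ge_atTop j.natAbs] with m hm
      have hj : j ∈ Finset.Icc (-(m : ℤ)) m := by
        simp only [Finset.mem_Icc]
        omega
      simp only [f, if_pos hj]
      rfl
    · refine Eventually.of_forall fun m j => ?_
      simp only [f]
      split_ifs
      · rw [norm_mul]
        gcongr
        exact hC _ _ _
      · rw [norm_zero]
        positivity
  have hlim' : Tendsto (fun m => ∑' j, f m j) atTop (𝓝 (ellTheta z p)) := by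
    simp only [hsum]
    exact (tendsto_prod_qPochInf z hp).mul (tendsto_prod_qPochInf (p / z) hp)
  rw [tendsto_nhds_unique hlim' hlim, tsum_mul_left, mul_inv_cancel_left₀ hE0]

/-! ### The addition formula -/

/-- Pairs of integers, split by the parity of their sum: `(k + l, k - l)` and
`(k + l + 1, k - l)`. -/
def parityEquiv : (ℤ × ℤ) ⊕ (ℤ × ℤ) ≃ ℤ × ℤ where
  toFun := Sum.elim (fun a => (a.1 + a.2, a.1 - a.2)) (fun a => (a.1 + a.2 + 1, a.1 - a.2))
  invFun b := if (b.1 + b.2) % 2 = 0 then Sum.inl ((b.1 + b.2) / 2, (b.1 - b.2) / 2)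
    else Sum.inr ((b.1 + b.2 - 1) / 2, (b.1 - b.2 - 1) / 2)
  left_inv := by
    rintro (⟨k, l⟩ | ⟨k, l⟩)
    · have h1 : (k + l + (k - l)) / 2 = k := by omega
      have h2 : (k + l - (k - l)) / 2 = l := by omega
      exact (if_pos (by change (k + l + (k - l)) % 2 = 0; omega)).trans
        (congrArg Sum.inl (Prod.ext h1 h2))
    · have h1 : (k + l + 1 + (k - l) - 1) / 2 = k := by omega
      have h2 : (k + l + 1 - (k - l) - 1) / 2 = l := by omega
      exact (if_neg (by change ¬(k + l + 1 + (k - l)) % 2 = 0; omega)).trans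
        (congrArg Sum.inr (Prod.ext h1 h2))
  right_inv := by
    rintro ⟨m, n⟩
    dsimp only
    split_ifs
    · simp only [Sum.elim_inl, Prod.mk.injEq]
      omega
    · simp only [Sum.elim_inr, Prod.mk.injEq]
      omega

/-- The even theta series `∑ p^{l²} y^{2l}`. -/
noncomputable def thetaEven (p y : ℂ) : ℂ := ∑' l : ℤ, thetaTerm (p ^ 2) (-(p * y ^ 2)) l

/-- The odd theta series `∑ p^{l²+l} y^{2l+1}`. -/
noncomputable def thetaOdd (p y : ℂ) : ℂ := ∑' l : ℤ, y * thetaTerm (p ^ 2) (-(p ^ 2 * y ^ 2)) l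

theorem thetaTerm_sq {p w : ℂ} (l : ℤ) :
    thetaTerm (p ^ 2) (-w) l = w ^ l * p ^ (l * (l - 1)) := by
  rw [thetaTerm, neg_neg, ← zpow_natCast p 2, ← zpow_mul,
    show ((2 : ℕ) : ℤ) * (l * (l - 1) / 2) = l * (l - 1) from
      Int.mul_ediv_cancel' (Int.even_mul_pred_self l).two_dvd]

/-- In the sum of the two quadratic exponents the cross term kl cancels, and the monomials combine
to x^{2k} y^{2l}; this separates the variables. -/
theorem thetaTerm_mul_even {p x y : ℂ} (hp0 : p ≠ 0) (hx : x ≠ 0) (hy : y ≠ 0) (k l : ℤ) :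
    thetaTerm p (x * y) (k + l) * thetaTerm p (x / y) (k - l) =
      thetaTerm (p ^ 2) (-x ^ 2) k * thetaTerm (p ^ 2) (-(p * y ^ 2)) l := by
  have e : (k + l) * (k + l - 1) / 2 + (k - l) * (k - l - 1) / 2 = k * (k - 1) + l * (l - 1) + l := by
    have h1 := Int.mul_ediv_cancel' (Int.even_mul_pred_self (k + l)).two_dvd
    have h2 := Int.mul_ediv_cancel' (Int.even_mul_pred_self (k - l)).two_dvd
    have : 2 * ((k + l) * (k + l - 1) / 2 + (k - l) * (k - l - 1) / 2) =
      2 * (k * (k - 1) + l * (l - 1) + l) := by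
      rw [mul_add, h1, h2]
      ring
    omega
  have hn : (-1 : ℂ) ≠ 0 := by norm_num
  rw [thetaTerm_sq, thetaTerm_sq, thetaTerm, thetaTerm,
    show ∀ a b c d : ℂ, a * b * (c * d) = a * c * (b * d) from fun a b c d => by ring,
    ← zpow_add₀ hp0, e, zpow_add₀ hp0, zpow_add₀ hp0, mul_zpow, ← neg_one_mul (x * y),
    ← neg_one_mul (x / y), mul_zpow, mul_zpow, mul_zpow _ (x / y), div_zpow, zpow_add₀ hx, zpow_sub₀ hx,
    zpow_add₀ hy, zpow_sub₀ hy, zpow_add₀ hn, zpow_sub₀ hn, ← zpow_natCast x 2,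
    ← zpow_natCast y 2, ← zpow_mul, ← zpow_mul, Nat.cast_ofNat, two_mul, two_mul,
    zpow_add₀ hx, zpow_add₀ hy]
  have hsq : ((-1 : ℂ) ^ k) * (-1) ^ k = 1 := by
    rw [← mul_zpow]
    simp
  have : x ^ l ≠ 0 := zpow_ne_zero _ hx
  have : y ^ k ≠ 0 := zpow_ne_zero _ hy
  have : y ^ l ≠ 0 := zpow_ne_zero _ hy
  have : (-1 : ℂ) ^ l ≠ 0 := zpow_ne_zero _ hn
  field_simp
  linear_combination hsq

theorem thetaTerm_mul_odd {p x y : ℂ} (hp0 : p ≠ 0) (hx : x ≠ 0) (hy : y ≠ 0) (k l : ℤ) :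
    thetaTerm p (x * y) (k + l + 1) * thetaTerm p (x / y) (k - l) =
      -(x * thetaTerm (p ^ 2) (-(p * x ^ 2)) k * (y * thetaTerm (p ^ 2) (-(p ^ 2 * y ^ 2)) l)) := by
  rw [thetaTerm_add_one hp0 (mul_ne_zero hx hy), mul_right_comm, thetaTerm_mul_even hp0 hx hy]
  simp only [thetaTerm_sq]
  simp only [mul_zpow, zpow_add₀ hp0, pow_two]
  ring

/-- Reindexing by one recognises the series in x that comes from the even pairs as x times the odd
theta series. -/
theorem thetaTerm_odd_shift {p x : ℂ} (hp0 : p ≠ 0) (hx : x ≠ 0) (k : ℤ) :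
    thetaTerm (p ^ 2) (-x ^ 2) (k + 1) = x * (x * thetaTerm (p ^ 2) (-(p ^ 2 * x ^ 2)) k) := by
  have h2 : p ^ 2 ≠ 0 := pow_ne_zero 2 hp0
  rw [thetaTerm_add_one h2 (neg_ne_zero.mpr (pow_ne_zero 2 hx))]
  simp only [thetaTerm_sq]
  simp only [mul_zpow, pow_two]
  ring

/-- Multiply the two triple product series and split the pairs of indices by the parity of their
sum. On each half the double series is a function of x times a function of y. -/
theorem ellTheta_mul_ellTheta_div_of_ne_zero {p : ℂ} (hp : ‖p‖ < 1) (hp0 : p ≠ 0) {x y : ℂ}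
    (hx : x ≠ 0) (hy : y ≠ 0) :
    qPochInf p p ^ 2 * (ellTheta (x * y) p * ellTheta (x / y) p) =
      x * (thetaOdd p x * thetaEven p y - thetaEven p x * thetaOdd p y) := by
  have hxy := mul_ne_zero hx hy
  have hxy' := div_ne_zero hx hy
  have hp2 : p ^ 2 ≠ 0 := pow_ne_zero 2 hp0
  have hp2' : ‖p ^ 2‖ < 1 := by
    rw [norm_pow]
    exact pow_lt_one₀ (norm_nonneg _) hp two_ne_zero
  have s : ∀ {w : ℂ}, w ≠ 0 → Summable (thetaTerm (p ^ 2) (-w)) := fun hw =>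
    summable_thetaTerm hp2' hp2 (neg_ne_zero.mpr hw)
  have sA : Summable (thetaTerm (p ^ 2) (-x ^ 2)) := s (pow_ne_zero 2 hx)
  have sE : ∀ {w : ℂ}, w ≠ 0 → Summable (thetaTerm (p ^ 2) (-(p * w ^ 2))) := fun hw =>
    s (mul_ne_zero hp0 (pow_ne_zero 2 hw))
  have sO : ∀ {w : ℂ}, w ≠ 0 → Summable fun l => w * thetaTerm (p ^ 2) (-(p ^ 2 * w ^ 2)) l :=
    fun hw => (s (mul_ne_zero hp2 (pow_ne_zero 2 hw))).mul_left _
  have hmul : ∀ {f g : ℤ → ℂ}, Summable f → Summable g →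
      HasSum (fun a : ℤ × ℤ => f a.1 * g a.2) ((∑' k, f k) * ∑' l, g l) := fun hf hg => by
    rw [tsum_mul_tsum_of_summable_norm hf.norm hg.norm]
    exact (summable_mul_of_summable_norm hf.norm hg.norm).hasSum
  have hAO : ∑' k, thetaTerm (p ^ 2) (-x ^ 2) k = x * thetaOdd p x := by
    rw [← (Equiv.addRight (1 : ℤ)).tsum_eq, thetaOdd, ← tsum_mul_left]
    exact tsum_congr fun k => thetaTerm_odd_shift hp0 hx k
  have h1 : HasSum (fun a : ℤ × ℤ => thetaTerm p (x * y) (a.1 + a.2) * thetaTerm p (x / y) (a.1 - a.2))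
      (x * thetaOdd p x * thetaEven p y) := by
    simp only [thetaTerm_mul_even hp0 hx hy]
    rw [← hAO]
    exact hmul sA (sE hy)
  have h2 : HasSum (fun a : ℤ × ℤ =>
      thetaTerm p (x * y) (a.1 + a.2 + 1) * thetaTerm p (x / y) (a.1 - a.2))
      (-(x * thetaEven p x * thetaOdd p y)) := by
    simp only [thetaTerm_mul_odd hp0 hx hy]
    rw [thetaEven, ← tsum_mul_left]
    exact (hmul ((sE hx).mul_left x) (sO hy)).neg
  have h3 : HasSum (fun a : ℤ × ℤ => thetaTerm p (x * y) a.1 * thetaTerm p (x / y) a.2)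
      (x * thetaOdd p x * thetaEven p y + -(x * thetaEven p x * thetaOdd p y)) := by
    rw [← parityEquiv.hasSum_iff]
    exact HasSum.sum h1 h2
  have h4 := h3.unique (hmul (summable_thetaTerm hp hp0 hxy) (summable_thetaTerm hp hp0 hxy'))
  rw [← ellTheta_triple_product hp hp0 hxy, ← ellTheta_triple_product hp hp0 hxy'] at h4
  linear_combination -h4

/-- The addition formula for theta functions, in determinantal form. -/
theorem exists_ellTheta_mul_ellTheta_div {p : ℂ} (hp : ‖p‖ < 1) :
    ∃ F₀ F₁ : ℂ → ℂ, ∀ x y : ℂ, x ≠ 0 → y ≠ 0 →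
      ellTheta (x * y) p * ellTheta (x / y) p = x * (F₁ x * F₀ y - F₀ x * F₁ y) := by
  -- The series use negative powers of p, so p = 0 is separate: there θ(z) = 1 - z and (1 - xy)(1 -
  -- x/y) = x((x + 1/x) - (y + 1/y)).
  by_cases hp0 : p = 0
  · subst hp0
    have h0 : ∀ z : ℂ, ellTheta z 0 = 1 - z := fun z => by
      rw [ellTheta, qPochInf_eq_mul (by simp), zero_div]
      simp [qPochInf]
    refine ⟨fun _ => 1, fun x => x + x⁻¹, fun x y hx hy => ?_⟩
    rw [h0, h0]
    field_simp
    ring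
  · refine ⟨thetaEven p, fun x => thetaOdd p x / qPochInf p p ^ 2, fun x y hx hy => ?_⟩
    have h := ellTheta_mul_ellTheta_div_of_ne_zero hp hp0 hx hy
    have := qPochInf_self_ne_zero hp
    field_simp
    linear_combination h

/-! ### Binary forms and their zeros -/

/-- Functions on `ℂ × ℂ` that behave like binary forms of degree `M`: homogeneous, and
polynomial along lines with the expected leading coefficient. -/
def IsBinaryForm (M : ℕ) (f : ℂ × ℂ → ℂ) : Prop :=
  (∀ (c : ℂ) (P : ℂ × ℂ), f (c • P) = c ^ M * f P) ∧
    ∀ P P₀ : ℂ × ℂ, ∃ Q : Polynomial ℂ,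
      Q.natDegree ≤ M ∧ Q.coeff M = f P₀ ∧ ∀ t : ℂ, f (P + t • P₀) = Q.eval t

namespace IsBinaryForm

theorem const (c : ℂ) : IsBinaryForm 0 fun _ => c :=
  ⟨fun _ _ => by simp, fun _ _ => ⟨Polynomial.C c, by simp, by simp, by simp⟩⟩

theorem linear (A B : ℂ) : IsBinaryForm 1 fun P => A * P.1 + B * P.2 := by
  refine ⟨fun c P => ?_, fun P P₀ =>
    ⟨Polynomial.C (A * P₀.1 + B * P₀.2) * Polynomial.X + Polynomial.C (A * P.1 + B * P.2),
      Polynomial.natDegree_linear_le, by simp, fun t => ?_⟩⟩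
  · simp only [Prod.smul_fst, Prod.smul_snd, smul_eq_mul]
    ring
  · simp only [Prod.fst_add, Prod.snd_add, Prod.smul_fst, Prod.smul_snd, smul_eq_mul,
      Polynomial.eval_add, Polynomial.eval_mul, Polynomial.eval_C, Polynomial.eval_X]
    ring

theorem mul {M M' : ℕ} {f g : ℂ × ℂ → ℂ} (hf : IsBinaryForm M f) (hg : IsBinaryForm M' g) :
    IsBinaryForm (M + M') fun P => f P * g P := by
  refine ⟨fun c P => ?_, fun P P₀ => ?_⟩
  · simp only [hf.1, hg.1]
    ring
  · obtain ⟨Q, h1, h2, h3⟩ := hf.2 P P₀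
    obtain ⟨R, k1, k2, k3⟩ := hg.2 P P₀
    refine ⟨Q * R, Polynomial.natDegree_mul_le.trans (add_le_add h1 k1), ?_, fun t => ?_⟩
    · rw [Polynomial.coeff_mul_add_eq_of_natDegree_le h1 k1, h2, k2]
    · simp only [Polynomial.eval_mul, h3, k3]

theorem const_mul {M : ℕ} {f : ℂ × ℂ → ℂ} (c : ℂ) (hf : IsBinaryForm M f) :
    IsBinaryForm M fun P => c * f P := by
  simpa using (const c).mul hf

theorem add {M : ℕ} {f g : ℂ × ℂ → ℂ} (hf : IsBinaryForm M f) (hg : IsBinaryForm M g) :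
    IsBinaryForm M fun P => f P + g P := by
  refine ⟨fun c P => ?_, fun P P₀ => ?_⟩
  · simp only [hf.1, hg.1]
    ring
  · obtain ⟨Q, h1, h2, h3⟩ := hf.2 P P₀
    obtain ⟨R, k1, k2, k3⟩ := hg.2 P P₀
    refine ⟨Q + R, (Polynomial.natDegree_add_le _ _).trans (max_le h1 k1), ?_, fun t => ?_⟩
    · rw [Polynomial.coeff_add, h2, k2]
    · simp only [Polynomial.eval_add, h3, k3]

theorem zero (M : ℕ) : IsBinaryForm M fun _ => 0 :=
  ⟨fun _ _ => by simp, fun _ _ => ⟨0, by simp, by simp, by simp⟩⟩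

theorem eq_smul_of_det_eq_zero {R P : ℂ × ℂ} (hP : P ≠ 0) (h : R.1 * P.2 - R.2 * P.1 = 0) :
    ∃ c : ℂ, R = c • P := by
  by_cases h1 : P.1 = 0
  · have h2 : P.2 ≠ 0 := fun h2 => hP (Prod.ext h1 h2)
    refine ⟨R.2 / P.2, Prod.ext ?_ ?_⟩
    · simp only [Prod.smul_fst, smul_eq_mul]
      rw [h1, mul_zero, sub_zero] at h
      rw [h1, mul_zero, (mul_eq_zero.mp h).resolve_right h2]
    · simp only [Prod.smul_snd, smul_eq_mul]
      field_simp
  · refine ⟨R.1 / P.1, Prod.ext ?_ ?_⟩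
    · simp only [Prod.smul_fst, smul_eq_mul]
      field_simp
    · simp only [Prod.smul_snd, smul_eq_mul]
      field_simp
      linear_combination -h

/-- A binary form of degree `M` with `M + 1` pairwise non-proportional zeros vanishes. -/
theorem eq_zero {ι : Type*} [Fintype ι] {f : ℂ × ℂ → ℂ} (hf : IsBinaryForm (Fintype.card ι) f)
    (P₀ : ℂ × ℂ) (Z : ι → ℂ × ℂ) (h₀ : ∀ i, P₀.1 * (Z i).2 - P₀.2 * (Z i).1 ≠ 0)
    (hZ : ∀ i j, i ≠ j → (Z i).1 * (Z j).2 - (Z i).2 * (Z j).1 ≠ 0)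
    (hf₀ : f P₀ = 0) (hfZ : ∀ i, f (Z i) = 0) (P : ℂ × ℂ) : f P = 0 := by
  -- The parameter at which the line through P in direction P₀ meets the span of `Z i`.
  set v : ι → ℂ := fun i =>
    -(P.1 * (Z i).2 - P.2 * (Z i).1) / (P₀.1 * (Z i).2 - P₀.2 * (Z i).1) with hv
  have hdet : ∀ i, (P + v i • P₀).1 * (Z i).2 - (P + v i • P₀).2 * (Z i).1 = 0 := fun i => by
    have h : v i * (P₀.1 * (Z i).2 - P₀.2 * (Z i).1) = -(P.1 * (Z i).2 - P.2 * (Z i).1) :=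
      div_mul_cancel₀ _ (h₀ i)
    simp only [Prod.fst_add, Prod.snd_add, Prod.smul_fst, Prod.smul_snd, smul_eq_mul]
    linear_combination h
  by_cases hinj : Function.Injective v
  -- The leading coefficient along the line is f(P₀) = 0, so the degree drops below M while there
  -- are M distinct roots.
  · obtain ⟨Q, h1, h2, h3⟩ := hf.2 P P₀
    rw [hf₀] at h2
    have hdeg : Q.degree < (Finset.univ : Finset ι).card := by
      rw [Finset.card_univ, Polynomial.degree_lt_iff_coeff_zero]
      intro k hk
      rcases hk.eq_or_lt with rfl | hk
      · exact h2
      · exact Polynomial.coeff_eq_zero_of_natDegree_lt (h1.trans_lt hk)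
    have hQ : Q = 0 := by
      refine Polynomial.eq_zero_of_degree_lt_of_eval_index_eq_zero _ hinj.injOn hdeg fun i _ => ?_
      have hZi : Z i ≠ 0 := fun h => h₀ i (by simp [h])
      obtain ⟨c, hc⟩ := eq_smul_of_det_eq_zero hZi (hdet i)
      rw [← h3, hc, hf.1, hfZ, mul_zero]
    simpa [hQ] using h3 0
  -- If two parameters coincide, the common point is proportional to two independent vectors. It is
  -- therefore zero, and P is a multiple of P₀.
  · simp only [Function.Injective, not_forall] at hinj
    obtain ⟨i, j, hij, hne⟩ := hinj
    have hi := hdet i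
    have hj := hdet j
    rw [← hij] at hj
    have hd := hZ i j hne
    set R := P + v i • P₀ with hR
    have hR1 : R.1 = 0 := (mul_eq_zero.mp (show R.1 *
      ((Z i).1 * (Z j).2 - (Z i).2 * (Z j).1) = 0 by
        linear_combination (Z i).1 * hj - (Z j).1 * hi)).resolve_right hd
    have hR2 : R.2 = 0 := (mul_eq_zero.mp (show R.2 *
      ((Z i).1 * (Z j).2 - (Z i).2 * (Z j).1) = 0 by
        linear_combination (Z i).2 * hj - (Z j).2 * hi)).resolve_right hd
    have hP : P = (-v i) • P₀ := by
      rw [neg_smul]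
      exact eq_neg_of_add_eq_zero_left (Prod.ext hR1 hR2)
    rw [hP, hf.1, hf₀, mul_zero]

end IsBinaryForm

/-! ### Elliptic shifted factorials -/

theorem ellFac_add (u q p : ℂ) (k m : ℕ) :
    ellFac u q p (k + m) = ellFac u q p m * ellFac (u * q ^ m) q p k := by
  rw [add_comm, ellFac, Finset.prod_range_add]
  refine congrArg _ (Finset.prod_congr rfl fun j _ => ?_)
  rw [pow_add, mul_assoc]

theorem ellFac_zero (u q p : ℂ) : ellFac u q p 0 = 1 := Finset.prod_range_zero _

theorem ellFac_ne_zero_iff {u q p : ℂ} {m : ℕ} :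
    ellFac u q p m ≠ 0 ↔ ∀ j < m, ellTheta (u * q ^ j) p ≠ 0 := by
  simp [ellFac, Finset.prod_ne_zero_iff]

theorem ellFac_one_eq_zero {p : ℂ} (hp : ‖p‖ < 1) (q : ℂ) {m : ℕ} (hm : m ≠ 0) :
    ellFac 1 q p m = 0 :=
  Finset.prod_eq_zero (Finset.mem_range.mpr (Nat.pos_of_ne_zero hm)) (by
    simpa using ellTheta_one hp)

theorem ellFac_mul_ellTheta (u q p : ℂ) (m : ℕ) :
    ellFac u q p m * ellTheta (u * q ^ m) p = ellTheta u p * ellFac (q * u) q p m := by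
  have h : ellFac u q p (m + 1) = ellFac u q p m * ellTheta (u * q ^ m) p :=
    Finset.prod_range_succ _ _
  have h' := ellFac_add u q p m 1
  have h1 : ellFac u q p 1 = ellTheta u p := by simp [ellFac]
  rw [← h, h', h1, pow_one, mul_comm u q]

/-- Inversion of the order of factors. -/
theorem ellFac_reflect {u q p : ℂ} (hp : ‖p‖ < 1) (hq0 : q ≠ 0) (hu : u ≠ 0) (m : ℕ) :
    ellFac u q p m =
      (∏ j ∈ Finset.range m, -(u * q ^ j)) * ellFac (q ^ (1 - m : ℤ) / u) q p m := by
  have h : ∀ j, ellTheta (u * q ^ j) p = -(u * q ^ j) * ellTheta (u * q ^ j)⁻¹ p := fun j => by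
    have hne : u * q ^ j ≠ 0 := mul_ne_zero hu (pow_ne_zero _ hq0)
    rw [ellTheta_inv hp hne]
    field_simp
  rw [ellFac, Finset.prod_congr rfl fun j _ => h j, Finset.prod_mul_distrib, ellFac]
  congr 1
  rw [← Finset.prod_range_reflect]
  refine Finset.prod_congr rfl fun j hj => ?_
  have hj' := Finset.mem_range.mp hj
  congr 1
  rw [mul_inv, ← zpow_natCast q j, ← zpow_natCast q (m - 1 - j), ← zpow_neg,
    show -((m - 1 - j : ℕ) : ℤ) = (1 - m) + j by omega, zpow_add₀ hq0]
  ring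

/-- `(q^{-N} v)_m` in terms of `(q / v)_N`. -/
theorem ellFac_neg_shift {v q p : ℂ} (hp : ‖p‖ < 1) (hq0 : q ≠ 0) (hv : v ≠ 0) {m N : ℕ}
    (hm : m ≤ N) :
    ellFac (q ^ (-(N : ℤ)) * v) q p m * ellFac (q / v) q p (N - m) =
      (∏ j ∈ Finset.range m, -(q ^ (-(N : ℤ)) * v * q ^ j)) * ellFac (q / v) q p N := by
  have e : N = m + (N - m) := by omega
  have h := ellFac_add (q / v) q p m (N - m)
  rw [← e] at h
  rw [ellFac_reflect hp hq0 (mul_ne_zero (zpow_ne_zero _ hq0) hv), h]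
  have : q ^ (1 - m : ℤ) / (q ^ (-(N : ℤ)) * v) = q / v * q ^ (N - m) := by
    rw [← zpow_natCast q (N - m), Nat.cast_sub hm, zpow_neg, zpow_sub₀ hq0, zpow_sub₀ hq0, zpow_one]
    have := zpow_ne_zero (N : ℤ) hq0
    field_simp
  rw [this]
  ring

/-- Split (q^{1-m}/v)_{m+N} after N and after m factors. The blocks of length m are reflections of
(q^{-N}v)_m and (v)_m, and q^{Nm} is the quotient of the two reflection prefactors. -/
theorem ellFac_cross {v q p : ℂ} (hp : ‖p‖ < 1) (hq0 : q ≠ 0) (hv : v ≠ 0) (m N : ℕ) :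
    ellFac (q ^ (-(N : ℤ)) * v) q p m * ellFac (q ^ (1 - m : ℤ) / v) q p N * q ^ (N * m) =
      ellFac v q p m * ellFac (q / v) q p N := by
  have h1 := ellFac_add (q ^ (1 - m : ℤ) / v) q p m N
  have h2 := ellFac_add (q ^ (1 - m : ℤ) / v) q p N m
  rw [add_comm N m] at h2
  have e1 : q ^ (1 - m : ℤ) / v * q ^ N = q ^ (1 - m : ℤ) / (q ^ (-(N : ℤ)) * v) := by
    rw [zpow_neg, zpow_natCast]
    field_simp
  have e2 : q ^ (1 - m : ℤ) / v * q ^ m = q / v := by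
    rw [zpow_sub₀ hq0, zpow_natCast, zpow_one]
    field_simp
  rw [e1] at h1
  rw [e2] at h2
  rw [ellFac_reflect hp hq0 (mul_ne_zero (zpow_ne_zero _ hq0) hv), ellFac_reflect hp hq0 hv m]
  have e3 : (∏ j ∈ Finset.range m, -(q ^ (-(N : ℤ)) * v * q ^ j)) * q ^ (N * m) =
      ∏ j ∈ Finset.range m, -(v * q ^ j) := by
    rw [pow_mul, ← Finset.card_range m, ← Finset.prod_const, Finset.card_range,
      ← Finset.prod_mul_distrib]
    refine Finset.prod_congr rfl fun j _ => ?_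
    rw [zpow_neg, zpow_natCast]
    field_simp
  rw [← e3]
  linear_combination (∏ j ∈ Finset.range m, -(q ^ (-(N : ℤ)) * v * q ^ j)) * q ^ (N * m) *
    (h2 - h1)

/-! ### Factors of the summand and their behaviour under a shift of the index -/

section Factors

variable {n : ℕ} (p q : ℂ) (x : Fin n → ℂ) (S : ℂ) (N l : Fin n → ℕ)

/-- The very-well-poised part of the summand. -/
noncomputable def wellPoisedFactor : ℂ :=
  ∏ i, ellTheta ((∏ k, x k) * x i * q ^ (l i + ∑ k, l k)) p / ellTheta ((∏ k, x k) * x i) p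

/-- The part of the summand indexed by pairs `i < j`. -/
noncomputable def pairFactor : ℂ :=
  ∏ i, ∏ j ∈ Finset.Ioi i,
    ellTheta (q ^ ((l i : ℤ) - (l j : ℤ)) * x i / x j) p / ellTheta (x i / x j) p
      * (1 / ellFac (q * S⁻¹ * x i * x j) q p (l i + l j))

/-- The part of the summand that terminates the sum. -/
noncomputable def terminatingFactor : ℂ :=
  ∏ i, ∏ j,
    ellFac (q ^ (-(N j : ℤ)) * x i / x j) q p (l i)
      * ellFac (q ^ (N j + 1) * S⁻¹ * x i * x j) q p (l i)

/-- The part of the summand with factors of length `|λ|` and `|λ| - λ_i`. -/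
noncomputable def totalFactor : ℂ :=
  ∏ i : Fin n,
    ellFac (S * (∏ k, x k) / x i) q p ((∑ k, l k) - l i) * q ^ (((i : ℕ) + 1) * l i)
      / (ellFac (q ^ (-(N i : ℤ)) * S * (∏ k, x k) / x i) q p (∑ k, l k)
          * ellFac (q ^ (N i + 1) * (∏ k, x k) * x i) q p (∑ k, l k))

/-- The part of the summand that does not involve the parameters `s_j` on their own. -/
noncomputable def coreFactor : ℂ :=
  wellPoisedFactor p q x l * pairFactor p q x S l * terminatingFactor p q x S N l
    * totalFactor p q x S N l

/-- The part of the summand that involves one parameter `s`. -/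
noncomputable def outerFactor (s : ℂ) : ℂ :=
  ellFac ((∏ k, x k) * s) q p (∑ k, l k) / ∏ i, ellFac (q * x i / s) q p (l i)

/-- `outerFactor`, multiplied by `∏ (q x_i / s)_{N_i}`. -/
noncomputable def clearedFactor (s : ℂ) : ℂ :=
  ellFac ((∏ k, x k) * s) q p (∑ k, l k) *
    ∏ i, ellFac (q ^ (l i + 1) * x i / s) q p (N i - l i)

/-- The summand, as a function of `x_i = s_i` for `i ≤ n`, the product `S` and the last three
parameters. -/
noncomputable def jacksonTerm (a b c : ℂ) : ℂ :=
  coreFactor p q x S N l * (∏ j, outerFactor p q x l (x j)) * outerFactor p q x l a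
    * outerFactor p q x l b * outerFactor p q x l c

/-- The closed form of the sum of `jacksonTerm`. -/
noncomputable def jacksonValue (a b c : ℂ) : ℂ :=
  ∏ i, (ellFac (q * (∏ k, x k) * x i) q p (N i) / ellFac (q * S⁻¹ * (∏ k, x k)⁻¹ * x i) q p (N i)
    * (ellFac (q * S⁻¹ * x i * a) q p (N i) / ellFac (q * x i / a) q p (N i)
      * (ellFac (q * S⁻¹ * x i * b) q p (N i) / ellFac (q * x i / b) q p (N i))
      * (ellFac (q * S⁻¹ * x i * c) q p (N i) / ellFac (q * x i / c) q p (N i))))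

/-- The parameters `q^{λ_i} x_i`. -/
def scaleParam : Fin n → ℂ := fun i => q ^ l i * x i

end Factors

section Cocycles

variable {n : ℕ} {p q : ℂ} {x : Fin n → ℂ} {S : ℂ} {N l μ : Fin n → ℕ}

theorem prod_scaleParam : ∏ k, scaleParam q x μ k = q ^ (∑ k, μ k) * ∏ k, x k := by
  simp only [scaleParam, Finset.prod_mul_distrib, Finset.prod_pow_eq_pow_sum]

theorem sum_add_apply : ∑ k, (l + μ) k = ∑ k, l k + ∑ k, μ k := by
  simp [Finset.sum_add_distrib]

/-- One of the cocycle relations that let a shift of the summation index be absorbed into the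
parameters. The quotients telescope: the theta values reached at μ are the denominators for the
scaled parameters, and must be nonzero to cancel. -/
theorem wellPoisedFactor_add
    (h : ∀ i, ellTheta ((∏ k, scaleParam q x μ k) * scaleParam q x μ i) p ≠ 0) :
    wellPoisedFactor p q x (l + μ) =
      wellPoisedFactor p q x μ * wellPoisedFactor p q (scaleParam q x μ) l := by
  unfold wellPoisedFactor
  rw [← Finset.prod_mul_distrib]
  refine Finset.prod_congr rfl fun i _ => ?_
  have hi := h i
  rw [sum_add_apply]
  have e1 : (∏ k, x k) * x i * q ^ ((l + μ) i + (∑ k, l k + ∑ k, μ k)) =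
      (∏ k, scaleParam q x μ k) * scaleParam q x μ i * q ^ (l i + ∑ k, l k) := by
    rw [prod_scaleParam, scaleParam, Pi.add_apply]
    ring
  have e2 : (∏ k, x k) * x i * q ^ (μ i + ∑ k, μ k) =
      (∏ k, scaleParam q x μ k) * scaleParam q x μ i := by
    rw [prod_scaleParam, scaleParam]
    ring
  rw [e1, e2]
  field_simp

theorem pairFactor_add (hq0 : q ≠ 0)
    (h : ∀ i j, i < j → ellTheta (scaleParam q x μ i / scaleParam q x μ j) p ≠ 0) :
    pairFactor p q x S (l + μ) = pairFactor p q x S μ * pairFactor p q (scaleParam q x μ) S l := by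
  unfold pairFactor
  simp only [← Finset.prod_mul_distrib]
  refine Finset.prod_congr rfl fun i _ => Finset.prod_congr rfl fun j hj => ?_
  have hij := h i j (Finset.mem_Ioi.mp hj)
  have e1 : q ^ (((l + μ) i : ℤ) - ((l + μ) j : ℤ)) * x i / x j =
      q ^ ((l i : ℤ) - (l j : ℤ)) * scaleParam q x μ i / scaleParam q x μ j := by
    simp only [scaleParam, Pi.add_apply, Nat.cast_add]
    rw [zpow_sub₀ hq0, zpow_sub₀ hq0, zpow_add₀ hq0, zpow_add₀ hq0]
    simp only [zpow_natCast]
    field_simp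
  have e2 : q ^ ((μ i : ℤ) - (μ j : ℤ)) * x i / x j =
      scaleParam q x μ i / scaleParam q x μ j := by
    simp only [scaleParam]
    rw [zpow_sub₀ hq0]
    simp only [zpow_natCast]
    field_simp
  have e3 : (l + μ) i + (l + μ) j = (l i + l j) + (μ i + μ j) := by
    simp only [Pi.add_apply]
    omega
  have e4 : q * S⁻¹ * x i * x j * q ^ (μ i + μ j) =
      q * S⁻¹ * scaleParam q x μ i * scaleParam q x μ j := by
    simp only [scaleParam]
    ring
  rw [e1, e2, e3, ellFac_add, e4]
  field_simp

theorem terminatingFactor_add (hq0 : q ≠ 0) (hμ : ∀ i, μ i ≤ N i) :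
    terminatingFactor p q x S N (l + μ) =
      terminatingFactor p q x S N μ * terminatingFactor p q (scaleParam q x μ) S (N - μ) l := by
  unfold terminatingFactor
  simp only [← Finset.prod_mul_distrib]
  refine Finset.prod_congr rfl fun i _ => Finset.prod_congr rfl fun j _ => ?_
  obtain ⟨d, hd⟩ := Nat.exists_eq_add_of_le (hμ j)
  have hd' : (N - μ) j = d := by
    simp only [Pi.sub_apply]
    omega
  have e1 : q ^ (-(N j : ℤ)) * x i / x j * q ^ μ i =
      q ^ (-((N - μ) j : ℤ)) * scaleParam q x μ i / scaleParam q x μ j := by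
    rw [hd', hd]
    simp only [scaleParam, zpow_neg, zpow_natCast, pow_add]
    field_simp
  have e2 : q ^ (N j + 1) * S⁻¹ * x i * x j * q ^ μ i =
      q ^ ((N - μ) j + 1) * S⁻¹ * scaleParam q x μ i * scaleParam q x μ j := by
    rw [hd', hd]
    simp only [scaleParam]
    ring
  rw [Pi.add_apply, ellFac_add, ellFac_add, e1, e2]
  ring

theorem totalFactor_add (hq0 : q ≠ 0) (hμ : ∀ i, μ i ≤ N i) :
    totalFactor p q x S N (l + μ) =
      totalFactor p q x S N μ * totalFactor p q (scaleParam q x μ) S (N - μ) l := by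
  unfold totalFactor
  simp only [← Finset.prod_mul_distrib]
  refine Finset.prod_congr rfl fun i _ => ?_
  obtain ⟨d, hd⟩ := Nat.exists_eq_add_of_le (hμ i)
  have hd' : (N - μ) i = d := by
    simp only [Pi.sub_apply]
    omega
  have hl : l i ≤ ∑ k, l k := Finset.single_le_sum (fun _ _ => Nat.zero_le _) (Finset.mem_univ i)
  have hm : μ i ≤ ∑ k, μ k := Finset.single_le_sum (fun _ _ => Nat.zero_le _) (Finset.mem_univ i)
  obtain ⟨e, he⟩ := Nat.exists_eq_add_of_le hm
  rw [sum_add_apply, prod_scaleParam]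
  have e0 : ∑ k, l k + ∑ k, μ k - (l + μ) i = (∑ k, l k - l i) + (∑ k, μ k - μ i) := by
    simp only [Pi.add_apply]
    omega
  have e1 : S * (∏ k, x k) / x i * q ^ (∑ k, μ k - μ i) =
      S * (q ^ (∑ k, μ k) * ∏ k, x k) / scaleParam q x μ i := by
    rw [he, Nat.add_sub_cancel_left]
    simp only [scaleParam, pow_add]
    field_simp
  have e2 : q ^ (-(N i : ℤ)) * S * (∏ k, x k) / x i * q ^ (∑ k, μ k) =
      q ^ (-((N - μ) i : ℤ)) * S * (q ^ (∑ k, μ k) * ∏ k, x k) / scaleParam q x μ i := by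
    rw [hd', hd]
    simp only [scaleParam, zpow_neg, zpow_natCast, pow_add]
    field_simp
  have e3 : q ^ (N i + 1) * (∏ k, x k) * x i * q ^ (∑ k, μ k) =
      q ^ ((N - μ) i + 1) * (q ^ (∑ k, μ k) * ∏ k, x k) * scaleParam q x μ i := by
    rw [hd', hd]
    simp only [scaleParam]
    ring
  have e4 : ((i : ℕ) + 1) * (l + μ) i = ((i : ℕ) + 1) * l i + ((i : ℕ) + 1) * μ i := by
    rw [Pi.add_apply, mul_add]
  rw [e0, ellFac_add, ellFac_add, ellFac_add, e1, e2, e3, e4, pow_add]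
  ring

theorem outerFactor_add (s : ℂ) :
    outerFactor p q x (l + μ) s =
      outerFactor p q x μ s * outerFactor p q (scaleParam q x μ) l s := by
  unfold outerFactor
  have e : ∀ i, ellFac (q * x i / s) q p ((l + μ) i) =
      ellFac (q * x i / s) q p (μ i) * ellFac (q * scaleParam q x μ i / s) q p (l i) := fun i => by
    rw [Pi.add_apply, ellFac_add, scaleParam]
    congr 2
    ring
  simp only [e]
  rw [sum_add_apply, ellFac_add, prod_scaleParam, Finset.prod_mul_distrib,
    show (∏ k, x k) * s * q ^ (∑ k, μ k) = q ^ (∑ k, μ k) * (∏ k, x k) * s by ring]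
  ring

theorem clearedFactor_add (s : ℂ) :
    clearedFactor p q x N (l + μ) s =
      ellFac ((∏ k, x k) * s) q p (∑ k, μ k) * clearedFactor p q (scaleParam q x μ) (N - μ) l s := by
  unfold clearedFactor
  have e : ∀ i, ellFac (q ^ ((l + μ) i + 1) * x i / s) q p (N i - (l + μ) i) =
      ellFac (q ^ (l i + 1) * scaleParam q x μ i / s) q p ((N - μ) i - l i) := fun i => by
    have : N i - (l + μ) i = (N - μ) i - l i := by
      simp only [Pi.add_apply, Pi.sub_apply]
      omega
    rw [this, scaleParam, Pi.add_apply]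
    congr 1
    ring
  simp only [e]
  rw [sum_add_apply, ellFac_add, prod_scaleParam,
    show (∏ k, x k) * s * q ^ (∑ k, μ k) = q ^ (∑ k, μ k) * (∏ k, x k) * s by ring]
  ring

theorem clearedFactor_eq {s : ℂ} (hl : ∀ i, l i ≤ N i)
    (h : ∀ i, ellFac (q * x i / s) q p (N i) ≠ 0) :
    clearedFactor p q x N l s =
      outerFactor p q x l s * ∏ i, ellFac (q * x i / s) q p (N i) := by
  unfold clearedFactor outerFactor
  have e : ∀ i, ellFac (q * x i / s) q p (N i) =
      ellFac (q * x i / s) q p (l i) * ellFac (q ^ (l i + 1) * x i / s) q p (N i - l i) :=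
    fun i => by
      conv_lhs => rw [show N i = (N i - l i) + l i by have := hl i; omega]
      rw [ellFac_add]
      congr 2
      ring
  have h' : ∏ i, ellFac (q * x i / s) q p (l i) ≠ 0 :=
    Finset.prod_ne_zero_iff.mpr fun i _ => left_ne_zero_of_mul (e i ▸ h i)
  simp only [e]
  rw [Finset.prod_mul_distrib]
  field_simp

theorem coreFactor_add (hq0 : q ≠ 0) (hμ : ∀ i, μ i ≤ N i)
    (h1 : ∀ i, ellTheta ((∏ k, scaleParam q x μ k) * scaleParam q x μ i) p ≠ 0)
    (h2 : ∀ i j, i < j → ellTheta (scaleParam q x μ i / scaleParam q x μ j) p ≠ 0) :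
    coreFactor p q x S N (l + μ) =
      coreFactor p q x S N μ * coreFactor p q (scaleParam q x μ) S (N - μ) l := by
  unfold coreFactor
  rw [wellPoisedFactor_add h1, pairFactor_add hq0 h2, terminatingFactor_add hq0 hμ,
    totalFactor_add hq0 hμ]
  ring

end Cocycles

/-! ### Genericity and one-variable product identities -/

/-- `z` is not in `q^ℤ` times a zero of the theta function. -/
def ThetaRegular (p q z : ℂ) : Prop := ∀ k : ℤ, ellTheta (q ^ k * z) p ≠ 0

theorem ThetaRegular.ellTheta_ne_zero {p q z w : ℂ} (h : ThetaRegular p q z) (k : ℤ)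
    (hw : w = q ^ k * z) : ellTheta w p ≠ 0 := hw ▸ h k

theorem ThetaRegular.ellFac_ne_zero {p q z w : ℂ} (h : ThetaRegular p q z) (hq0 : q ≠ 0) (k : ℤ)
    (m : ℕ) (hw : w = q ^ k * z) : ellFac w q p m ≠ 0 := by
  rw [ellFac_ne_zero_iff]
  intro j _
  refine h.ellTheta_ne_zero (k + j) ?_
  rw [hw, zpow_add₀ hq0, zpow_natCast]
  ring

theorem ThetaRegular.inv {p q z : ℂ} (hp : ‖p‖ < 1) (hq0 : q ≠ 0) (hz : z ≠ 0)
    (h : ThetaRegular p q z) : ThetaRegular p q z⁻¹ := by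
  intro k
  have hne : q ^ (-k) * z ≠ 0 := mul_ne_zero (zpow_ne_zero _ hq0) hz
  have e : q ^ k * z⁻¹ = (q ^ (-k) * z)⁻¹ := by
    rw [zpow_neg, mul_inv, inv_inv]
  rw [e, ellTheta_inv hp hne]
  exact mul_ne_zero (neg_ne_zero.mpr (inv_ne_zero hne)) (h (-k))

section Scalar

variable {p q : ℂ}

/-- The theta quotient turns (v)_k into (qv)_k, and (qv)_{k+N} = (qv)_{M+m} is then split in two
ways. Off the diagonal k = m and M = N; on the diagonal k = 2m. -/
theorem ellFac_wellPoised_ratio (hq0 : q ≠ 0) {v : ℂ} (hv : ThetaRegular p q v) (m k N M : ℕ)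
    (hN : k + N = M + m) :
    ellTheta (v * q ^ k) p / ellTheta v p * ellFac v q p k / ellFac (q ^ (M + 1) * v) q p m *
      ellFac (q ^ (k + 1) * v) q p N = ellFac (q * v) q p M := by
  have h1 := ellFac_mul_ellTheta v q p k
  have h2 := ellFac_add (q * v) q p N k
  have h3 := ellFac_add (q * v) q p m M
  rw [show N + k = m + M by omega, h3] at h2
  rw [show q * v * q ^ M = q ^ (M + 1) * v by ring, show q * v * q ^ k = q ^ (k + 1) * v by ring]
    at h2
  have n1 : ellTheta v p ≠ 0 := hv.ellTheta_ne_zero 0 (by simp)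
  have n2 : ellFac (q ^ (M + 1) * v) q p m ≠ 0 :=
    hv.ellFac_ne_zero hq0 (M + 1 : ℕ) m (by rw [zpow_natCast])
  generalize ellFac (q ^ (M + 1) * v) q p m = A at *
  generalize ellFac (q ^ (k + 1) * v) q p N = B at *
  generalize ellFac (q * v) q p M = C at *
  field_simp
  linear_combination B * h1 - ellTheta v p * h2

theorem ellFac_pair_ratio (hp : ‖p‖ < 1) (hq0 : q ≠ 0) {v : ℂ} (hv0 : v ≠ 0)
    (hv : ThetaRegular p q v) (m N : ℕ) :
    ellTheta (q ^ m * v) p / ellTheta v p * ellFac (q ^ (-(N : ℤ)) * v) q p m / ellFac (q * v) q p m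
      * ellFac (q ^ (1 - m : ℤ) / v) q p N / ellFac (q / v) q p N = (q ^ (N * m))⁻¹ := by
  have h1 := ellFac_mul_ellTheta v q p m
  have h2 := ellFac_cross hp hq0 hv0 m N
  have n1 : ellTheta v p ≠ 0 := hv.ellTheta_ne_zero 0 (by simp)
  have n2 : ellFac (q * v) q p m ≠ 0 := hv.ellFac_ne_zero hq0 1 m (by simp)
  have n3 : ellFac (q / v) q p N ≠ 0 :=
    (hv.inv hp hq0 hv0).ellFac_ne_zero hq0 1 N (by rw [zpow_one, div_eq_mul_inv])
  have n4 : q ^ (N * m) ≠ 0 := pow_ne_zero _ hq0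
  rw [mul_comm v] at h1
  generalize ellFac (q ^ (-(N : ℤ)) * v) q p m = A at *
  generalize ellFac (q * v) q p m = B at *
  generalize ellFac (q / v) q p N = C at *
  field_simp
  linear_combination ellTheta (q ^ m * v) p * h2 + C * h1

theorem ellFac_swap_ratio {v : ℂ} {m : ℕ} (N : ℕ) (h : ellFac (q * v) q p m ≠ 0) :
    ellFac (q ^ (N + 1) * v) q p m * ellFac (q * v) q p N / ellFac (q * v) q p m =
      ellFac (q ^ (m + 1) * v) q p N := by
  have h2 := ellFac_add (q * v) q p N m
  have h3 := ellFac_add (q * v) q p m N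
  rw [add_comm N m, h3] at h2
  rw [show q * v * q ^ N = q ^ (N + 1) * v by ring, show q * v * q ^ m = q ^ (m + 1) * v by ring]
    at h2
  generalize ellFac (q * v) q p m = A at *
  generalize ellFac (q * v) q p N = B at *
  generalize ellFac (q ^ (m + 1) * v) q p N = C at *
  field_simp
  linear_combination h2

theorem ellFac_total_ratio (hp : ‖p‖ < 1) (hq0 : q ≠ 0) {v : ℂ} (hv0 : v ≠ 0)
    (hv : ThetaRegular p q v) (m N : ℕ) :
    ellFac v q p m / ellFac (q ^ (-(N : ℤ)) * v) q p m / ellFac (q ^ (1 - m : ℤ) / v) q p N =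
      q ^ (N * m) / ellFac (q / v) q p N := by
  have h2 := ellFac_cross hp hq0 hv0 m N
  have n1 : ellFac (q ^ (-(N : ℤ)) * v) q p m ≠ 0 := hv.ellFac_ne_zero hq0 _ m rfl
  have n2 : ellFac (q ^ (1 - m : ℤ) / v) q p N ≠ 0 :=
    (hv.inv hp hq0 hv0).ellFac_ne_zero hq0 _ N (by rw [div_eq_mul_inv])
  have n3 : ellFac (q / v) q p N ≠ 0 :=
    (hv.inv hp hq0 hv0).ellFac_ne_zero hq0 1 N (by rw [zpow_one, div_eq_mul_inv])
  generalize ellFac (q ^ (-(N : ℤ)) * v) q p m = A at *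
  field_simp
  linear_combination -h2

/-- The factors belonging to an unshifted index, with u = x_i and x = x_r. They fall into blocks in
Xu, x/u, xu/S and SX/u, one for each of the four ratio identities; the powers q^{Nm} of the second
and fourth blocks cancel. -/
theorem jacksonValue_shift_offDiag (hp : ‖p‖ < 1) (hq0 : q ≠ 0) {x u X S b c : ℂ} (m N : ℕ)
    (hx : x ≠ 0) (hu : u ≠ 0) (hX : X ≠ 0) (hS : S ≠ 0)
    (h1 : ThetaRegular p q (X * u)) (h2 : ThetaRegular p q (x / u))
    (h3 : ThetaRegular p q (x * u / S)) (h4 : ThetaRegular p q (S * X / u))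
    (h5 : ellFac (q * u / c) q p N ≠ 0) :
    ellTheta (X * u * q ^ m) p / ellTheta (X * u) p
      * (ellTheta (q ^ m * (x / u)) p / ellTheta (x / u) p * (1 / ellFac (q * S⁻¹ * x * u) q p m))
      * (ellFac (q ^ (-(N : ℤ)) * x / u) q p m * ellFac (q ^ (N + 1) * S⁻¹ * x * u) q p m)
      * (ellFac (S * X / u) q p m /
          (ellFac (q ^ (-(N : ℤ)) * S * X / u) q p m * ellFac (q ^ (N + 1) * X * u) q p m))
      * (ellFac (X * u) q p m / ellFac (q * x / u) q p m)
      * (ellFac (q * u / (q ^ m * x)) q p N * ellFac (q * u / c) q p N)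
      * (ellFac (q * (q ^ m * X) * u) q p N / ellFac (q * S⁻¹ * (q ^ m * X)⁻¹ * u) q p N
        * (ellFac (q * S⁻¹ * u * x) q p N / ellFac (q * u / x) q p N
          * (ellFac (q * S⁻¹ * u * b) q p N / ellFac (q * u / b) q p N)
          * (ellFac (q * S⁻¹ * u * c) q p N / ellFac (q * u / c) q p N)))
    = ellFac (q * X * u) q p N / ellFac (q * S⁻¹ * X⁻¹ * u) q p N
      * ellFac (q * S⁻¹ * u * (q ^ m * x)) q p N
      * (ellFac (q * S⁻¹ * u * b) q p N / ellFac (q * u / b) q p N)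
      * ellFac (q * S⁻¹ * u * c) q p N := by
  have E1 := ellFac_wellPoised_ratio hq0 h1 m m N N (add_comm _ _)
  have E2 := ellFac_pair_ratio hp hq0 (div_ne_zero hx hu) h2 m N
  have E3 := ellFac_swap_ratio (v := x * u / S) N
    (h3.ellFac_ne_zero hq0 1 m (by rw [zpow_one]))
  have E4 := ellFac_total_ratio hp hq0 (div_ne_zero (mul_ne_zero hS hX) hu) h4 m N
  have hz : q ^ (1 - m : ℤ) = q / q ^ m := by rw [zpow_sub₀ hq0, zpow_one, zpow_natCast]
  have hqm : q ^ m ≠ 0 := pow_ne_zero _ hq0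
  have a1 : q * S⁻¹ * x * u = q * (x * u / S) := by ring
  have a2 : q ^ (-(N : ℤ)) * x / u = q ^ (-(N : ℤ)) * (x / u) := by ring
  have a3 : q ^ (N + 1) * S⁻¹ * x * u = q ^ (N + 1) * (x * u / S) := by ring
  have a4 : q ^ (-(N : ℤ)) * S * X / u = q ^ (-(N : ℤ)) * (S * X / u) := by ring
  have a5 : q ^ (N + 1) * X * u = q ^ (N + 1) * (X * u) := by ring
  have a6 : q * x / u = q * (x / u) := by ring
  have a7 : q * u / (q ^ m * x) = q ^ (1 - m : ℤ) / (x / u) := by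
    rw [hz]
    field_simp
  have a8 : q * (q ^ m * X) * u = q ^ (m + 1) * (X * u) := by ring
  have a9 : q * S⁻¹ * (q ^ m * X)⁻¹ * u = q ^ (1 - m : ℤ) / (S * X / u) := by
    rw [hz]
    field_simp
  have a10 : q * S⁻¹ * u * x = q * (x * u / S) := by ring
  have a11 : q * u / x = q / (x / u) := by field_simp
  have a12 : q * X * u = q * (X * u) := by ring
  have a13 : q * S⁻¹ * X⁻¹ * u = q / (S * X / u) := by field_simp
  have a14 : q * S⁻¹ * u * (q ^ m * x) = q ^ (m + 1) * (x * u / S) := by ring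
  have hN : q ^ (N * m) ≠ 0 := pow_ne_zero _ hq0
  rw [a1, a2, a3, a4, a5, a6, a7, a8, a9, a10, a11, a12, a13, a14, ← E1, ← E3]
  rw [div_div] at E4
  rw [mul_div_assoc, div_eq_mul_inv, div_eq_mul_inv, div_eq_mul_inv] at E2
  rw [div_eq_mul_inv _ (ellFac (q / (S * X / u)) q p N),
    show (ellFac (q / (S * X / u)) q p N)⁻¹ = (q ^ (N * m))⁻¹ * (q ^ (N * m) /
      ellFac (q / (S * X / u)) q p N) by field_simp, ← E2, ← E4]
  -- What remains is (qu/c)_N times its inverse. Exposing it as a factor leaves an identity of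
  -- monomials in formal inverses.
  refine Eq.trans ?_ ((congrArg (HMul.hMul _) (mul_inv_cancel₀ h5)).trans (mul_one _))
  ring_nf

theorem prod_pow_odd (q : ℂ) (m : ℕ) : ∏ j ∈ Finset.range m, q ^ (2 * j + 1) = q ^ (m * m) := by
  induction m with
  | zero => simp
  | succ m ih =>
    rw [Finset.prod_range_succ, ih, ← pow_add]
    congr 1
    ring

/-- Compares the prefactors from reversing (Xc)_m, (Xb)_m, (q^{-N})_m and (q^{-N}SX/x)_m. The excess
∏ q^{2j+1} = q^{m²} on the left is exactly the q^m that the balancing condition puts into each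
factor on the right. -/
theorem prod_reflect_powers {x X S b c : ℂ} {m : ℕ} (hx : x ≠ 0) (hS : S = X * (q ^ m * x) * b * c) (w : ℂ) :
    (∏ j ∈ Finset.range m, -(X * c * q ^ j)) * (∏ j ∈ Finset.range m, -(X * b * q ^ j)) *
      (∏ j ∈ Finset.range m, -(w * 1 * q ^ j)) * q ^ m =
      ∏ j ∈ Finset.range m, -(w * (S * X / x) * q ^ j) := by
  have e : q ^ m = ∏ j ∈ Finset.range m, q := by simp
  conv_lhs => rw [e]
  rw [← Finset.prod_mul_distrib, ← Finset.prod_mul_distrib, ← Finset.prod_mul_distrib]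
  have l1 : ∀ j ∈ Finset.range m, -(X * c * q ^ j) * -(X * b * q ^ j) * -(w * 1 * q ^ j) * q =
      q ^ (2 * j + 1) * -(X ^ 2 * b * c * w * q ^ j) := fun j _ => by
    ring
  have l2 : ∀ j ∈ Finset.range m, -(w * (S * X / x) * q ^ j) =
      q ^ m * -(X ^ 2 * b * c * w * q ^ j) := fun j _ => by
    rw [hS]
    field_simp
  rw [Finset.prod_congr rfl l1, Finset.prod_congr rfl l2, Finset.prod_mul_distrib,
    Finset.prod_mul_distrib, prod_pow_odd, Finset.prod_const, Finset.card_range, pow_mul]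

/-- The field algebra of the diagonal case over bare letters: PA, PB, PC, PD are the reflection
prefactors of `prod_reflect_powers`, and M stands for q^m. -/
theorem diag_cancellation {PA PB PC PD M A5 A6 V V' Q Q' Q1 Z : ℂ}
    (t f1 f2 f3 f4 f5 f6 f7 f8 f9 g1 g2 Y : ℂ) (hpow : PA * PB * PC * M = PD)
    (D5 : A5 * V = PD * V') (D6 : A6 * Q1 = PC * (Q * Q')) (hA5 : A5 ≠ 0) (hV : V ≠ 0)
    (hV' : V' ≠ 0) (hQ : Q ≠ 0) (hQ' : Q' ≠ 0) (hZ : Z ≠ 0) :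
    t * (A6 * f1) * (M / (A5 * f2)) * (f3 / Q) * (PB * g2 / f4) * (f5 * (PA * g1)) * (Q1 * Z) *
        (f6 / V * (f7 / Q' * (f8 / Y) * (f9 / Z))) =
      t * (f3 * f5) / f2 * f6 / V' * (f7 * f1) * (g1 * f8 / (f4 * Y)) * (g2 * f9) := by
  have e1 : A6 / (Q * Q') * Q1 = PC := by
    field_simp
    linear_combination D6
  have hPD : PD ≠ 0 := by
    rintro rfl
    rw [zero_mul] at D5
    exact mul_ne_zero hA5 hV D5
  have e2 : PA * PB * PC * M * (A5 * V)⁻¹ = V'⁻¹ := by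
    rw [D5, hpow]
    field_simp
  rw [← e1] at e2
  rw [div_eq_mul_inv _ V', ← e2]
  refine Eq.trans ?_ ((congrArg (HMul.hMul _) (mul_inv_cancel₀ hZ)).trans (mul_one _))
  ring

/-- The factors belonging to the shifted index r. By the balancing condition, (Xc)_m and (Xb)_m
reflect to (qxb/S)_m and (qxc/S)_m, which are the m factors missing from the shifted closed form. -/
theorem jacksonValue_shift_diag (hp : ‖p‖ < 1) (hq0 : q ≠ 0) {x X S b c M : ℂ} {m N : ℕ}
    (hM : M = q ^ m)
    (hm : m ≤ N) (hx : x ≠ 0) (hX : X ≠ 0) (hb : b ≠ 0) (hc : c ≠ 0)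
    (hS : S = X * (q ^ m * x) * b * c)
    (h1 : ThetaRegular p q (X * x)) (h2 : ThetaRegular p q (S * X / x))
    (h3 : ellFac q q p N ≠ 0) (h4 : ellFac (q * (q ^ m * x) / c) q p (N - m) ≠ 0) :
    ellTheta (X * x * q ^ (m + m)) p / ellTheta (X * x) p
      * (ellFac (q ^ (-(N : ℤ)) * x / x) q p m * ellFac (q ^ (N + 1) * S⁻¹ * x * x) q p m)
      * (M /
          (ellFac (q ^ (-(N : ℤ)) * S * X / x) q p m * ellFac (q ^ (N + 1) * X * x) q p m))
      * (ellFac (X * x) q p m / ellFac (q * x / x) q p m)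
      * (ellFac (X * b) q p m / ellFac (q * x / b) q p m)
      * (ellFac (X * (q ^ m * x)) q p m * ellFac (X * c) q p m)
      * (ellFac (q * (q ^ m * x) / (q ^ m * x)) q p (N - m)
          * ellFac (q * (q ^ m * x) / c) q p (N - m))
      * (ellFac (q * (q ^ m * X) * (q ^ m * x)) q p (N - m)
          / ellFac (q * S⁻¹ * (q ^ m * X)⁻¹ * (q ^ m * x)) q p (N - m)
        * (ellFac (q * S⁻¹ * (q ^ m * x) * x) q p (N - m)
            / ellFac (q * (q ^ m * x) / x) q p (N - m)
          * (ellFac (q * S⁻¹ * (q ^ m * x) * b) q p (N - m)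
              / ellFac (q * (q ^ m * x) / b) q p (N - m))
          * (ellFac (q * S⁻¹ * (q ^ m * x) * c) q p (N - m)
              / ellFac (q * (q ^ m * x) / c) q p (N - m))))
    = ellFac (q * X * x) q p N / ellFac (q * S⁻¹ * X⁻¹ * x) q p N
      * ellFac (q * S⁻¹ * x * (q ^ m * x)) q p N
      * (ellFac (q * S⁻¹ * x * b) q p N / ellFac (q * x / b) q p N)
      * ellFac (q * S⁻¹ * x * c) q p N := by
  subst hM
  have hqm : q ^ m ≠ 0 := pow_ne_zero _ hq0
  have hS0 : S ≠ 0 := by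
    rw [hS]
    simp [hX, hqm, hx, hb, hc]
  have hz : q ^ (1 - m : ℤ) = q / q ^ m := by rw [zpow_sub₀ hq0, zpow_one, zpow_natCast]
  obtain ⟨d, rfl⟩ := Nat.exists_eq_add_of_le hm
  rw [Nat.add_sub_cancel_left] at *
  have hv0 : S * X / x ≠ 0 := div_ne_zero (mul_ne_zero hS0 hX) hx
  have D1 := ellFac_wellPoised_ratio hq0 h1 m (m + m) d (m + d) (by omega)
  rw [ellFac_add _ _ _ m m] at D1
  have D2 := ellFac_add (q ^ (m + 1) * (x * x / S)) q p m d
  have D3 := ellFac_add (q * S⁻¹ * x * b) q p d m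
  have D4 := ellFac_add (q * S⁻¹ * x * c) q p d m
  have D5 := ellFac_neg_shift hp hq0 hv0 hm
  have D6 := ellFac_neg_shift hp hq0 one_ne_zero hm
  have D7 := ellFac_add q q p d m
  have D8 := ellFac_add (q * x / b) q p d m
  rw [Nat.add_sub_cancel_left] at D5 D6
  rw [add_comm d m] at D3 D4 D7 D8
  have R3 := ellFac_reflect (p := p) hp hq0 (mul_ne_zero hX hc) m
  have R4 := ellFac_reflect (p := p) hp hq0 (mul_ne_zero hX hb) m
  rw [show q ^ (1 - m : ℤ) / (X * c) = q * S⁻¹ * x * b by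
    rw [hz, hS]; field_simp] at R3
  rw [show q ^ (1 - m : ℤ) / (X * b) = q * S⁻¹ * x * c by
    rw [hz, hS]; field_simp] at R4
  have hpow := prod_reflect_powers hx hS (q ^ (-((m + d : ℕ) : ℤ)))
  have n5 : ellFac (q ^ (-((m + d : ℕ) : ℤ)) * (S * X / x)) q p m ≠ 0 :=
    h2.ellFac_ne_zero hq0 _ m rfl
  have n5' : ∀ k, ellFac (q / (S * X / x)) q p k ≠ 0 := fun k =>
    (h2.inv hp hq0 hv0).ellFac_ne_zero hq0 1 k (by rw [zpow_one, div_eq_mul_inv])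
  have n7 := h3
  rw [D7] at n7
  have a2 : q ^ (-((m + d : ℕ) : ℤ)) * x / x = q ^ (-((m + d : ℕ) : ℤ)) * 1 := by field_simp
  have a3 : q ^ (m + d + 1) * S⁻¹ * x * x = q ^ (m + 1) * (x * x / S) * q ^ d := by ring
  have a4 : q ^ (-((m + d : ℕ) : ℤ)) * S * X / x = q ^ (-((m + d : ℕ) : ℤ)) * (S * X / x) := by
    ring
  have a5 : q ^ (m + d + 1) * X * x = q ^ (m + d + 1) * (X * x) := by ring
  have a6 : q * x / x = q := by field_simp
  have a7 : X * (q ^ m * x) = X * x * q ^ m := by ring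
  have a8 : q * (q ^ m * x) / (q ^ m * x) = q / 1 := by field_simp
  have a9 : q * (q ^ m * X) * (q ^ m * x) = q ^ (m + m + 1) * (X * x) := by ring
  have a10 : q * S⁻¹ * (q ^ m * X)⁻¹ * (q ^ m * x) = q / (S * X / x) := by field_simp
  have a11 : q * S⁻¹ * (q ^ m * x) * x = q ^ (m + 1) * (x * x / S) := by ring
  have a12 : q * (q ^ m * x) / x = q * q ^ m := by field_simp
  have a13 : q * S⁻¹ * (q ^ m * x) * b = q * S⁻¹ * x * b * q ^ m := by ring
  have a14 : q * (q ^ m * x) / b = q * x / b * q ^ m := by ring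
  have a15 : q * S⁻¹ * (q ^ m * x) * c = q * S⁻¹ * x * c * q ^ m := by ring
  have a16 : q * X * x = q * (X * x) := by ring
  have a17 : q * S⁻¹ * X⁻¹ * x = q / (S * X / x) := by field_simp
  have a18 : q * S⁻¹ * x * (q ^ m * x) = q ^ (m + 1) * (x * x / S) := by ring
  rw [div_one, D7] at D6
  rw [a2, a3, a4, a5, a6, a7, a8, a9, a10, a11, a12, a13, a14, a15, a16, a17, a18, ← D1, D2, D3,
    D4, D8, R3, R4, div_one]
  exact diag_cancellation _ _ _ _ _ _ _ _ _ _ _ _ _ hpow D5 D6 n5 (n5' d) (n5' (m + d))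
    (left_ne_zero_of_mul n7) (right_ne_zero_of_mul n7) h4

end Scalar

/-! ### Shifting a single coordinate -/

theorem prod_Ioi_eq_prod_erase {n : ℕ} (g : Fin n → Fin n → ℂ) (r : Fin n)
    (h : ∀ i j, i ≠ r → j ≠ r → g i j = 1) :
    ∏ i, ∏ j ∈ Finset.Ioi i, g i j =
      ∏ i ∈ Finset.univ.erase r, if i < r then g i r else g r i := by
  rw [← Finset.mul_prod_erase _ _ (Finset.mem_univ r)]
  have h1 : ∏ j ∈ Finset.Ioi r, g r j =
      ∏ i ∈ Finset.univ.erase r, if r < i then g r i else 1 := by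
    rw [← Finset.prod_filter]
    refine Finset.prod_congr ?_ fun _ _ => rfl
    ext i
    simp only [Finset.mem_Ioi, Finset.mem_filter, Finset.mem_erase, Finset.mem_univ, and_true]
    exact ⟨fun hi => ⟨hi.ne', hi⟩, fun hi => hi.2⟩
  rw [h1, ← Finset.prod_mul_distrib]
  refine Finset.prod_congr rfl fun i hi => ?_
  have hir : i ≠ r := Finset.ne_of_mem_erase hi
  rcases lt_or_gt_of_ne hir with hlt | hgt
  · rw [if_neg hlt.not_gt, if_pos hlt, one_mul, Finset.prod_eq_single r]
    · exact fun j _ hj => h i j hir hj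
    · exact fun hr => absurd (Finset.mem_Ioi.mpr hlt) hr
  · rw [if_pos hgt, if_neg hgt.not_gt, Finset.prod_eq_one, mul_one]
    intro j hj
    exact h i j hir (ne_of_gt (hgt.trans (Finset.mem_Ioi.mp hj)))

theorem prod_erase_ite_lt {n : ℕ} (r : Fin n) (z : ℂ) :
    ∏ i ∈ Finset.univ.erase r, (if i < r then z else 1) = z ^ (r : ℕ) := by
  rw [← Finset.prod_filter, Finset.prod_const]
  congr 1
  rw [← Fin.card_Iio r]
  congr 1
  ext i
  simp only [Finset.mem_Iio, Finset.mem_filter, Finset.mem_erase, Finset.mem_univ, and_true]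
  exact ⟨fun hi => hi.2, fun hi => ⟨hi.ne, hi⟩⟩

theorem ellTheta_ratio_inv {p q v : ℂ} (hp : ‖p‖ < 1) (hq0 : q ≠ 0) (hv : v ≠ 0) (m : ℕ) :
    ellTheta (q ^ (-(m : ℤ)) * v⁻¹) p / ellTheta v⁻¹ p =
      (q ^ m)⁻¹ * (ellTheta (q ^ m * v) p / ellTheta v p) := by
  have hqm : q ^ m ≠ 0 := pow_ne_zero _ hq0
  rw [zpow_neg, zpow_natCast, ← mul_inv, ellTheta_inv hp (mul_ne_zero hqm hv), ellTheta_inv hp hv]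
  rw [mul_inv]
  field_simp

section Single

variable {n : ℕ} {p q : ℂ} {x : Fin n → ℂ} {S : ℂ} {N : Fin n → ℕ} {r : Fin n} {m : ℕ}

theorem sum_single : ∑ k, (Pi.single r m : Fin n → ℕ) k = m := by
  simp

/-- Only pairs containing r contribute. For i < r the quotient appears as x_i/x_r, and inverting it
costs q^{-m}; with indices from 0 there are r such i. -/
theorem pairFactor_single (hp : ‖p‖ < 1) (hq0 : q ≠ 0) (hx : ∀ i, x i ≠ 0)
    (h : ∀ i j, i < j → ellTheta (x i / x j) p ≠ 0) :
    pairFactor p q x S (Pi.single r m) = ((q ^ m)⁻¹) ^ (r : ℕ) *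
      ∏ i ∈ Finset.univ.erase r, (ellTheta (q ^ m * (x r / x i)) p / ellTheta (x r / x i) p
        * (1 / ellFac (q * S⁻¹ * x r * x i) q p m)) := by
  unfold pairFactor
  set μ : Fin n → ℕ := Pi.single r m with hμ
  have hr : μ r = m := by simp [hμ]
  have h0 : ∀ i, i ≠ r → μ i = 0 := fun i hi => by simp [hμ, hi]
  have hcongr : ∀ i, ∀ j ∈ Finset.Ioi i, ellTheta (q ^ ((μ i : ℤ) - (μ j : ℤ)) * x i / x j) p
      / ellTheta (x i / x j) p * (1 / ellFac (q * S⁻¹ * x i * x j) q p (μ i + μ j)) =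
      if i ≠ r ∧ j ≠ r then 1 else ellTheta (q ^ ((μ i : ℤ) - (μ j : ℤ)) * x i / x j) p
      / ellTheta (x i / x j) p * (1 / ellFac (q * S⁻¹ * x i * x j) q p (μ i + μ j)) := by
    intro i j hj
    split_ifs with hij
    · rw [h0 i hij.1, h0 j hij.2, ellFac_zero]
      simp [div_self (h i j (Finset.mem_Ioi.mp hj))]
    · rfl
  rw [Finset.prod_congr rfl fun i _ => Finset.prod_congr rfl (hcongr i),
    prod_Ioi_eq_prod_erase _ r (fun i j hi hj => if_pos ⟨hi, hj⟩), ← prod_erase_ite_lt r,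
    ← Finset.prod_mul_distrib]
  refine Finset.prod_congr rfl fun i hi => ?_
  have hir : i ≠ r := Finset.ne_of_mem_erase hi
  have hne : ¬(i ≠ r ∧ r ≠ r) := fun h => h.2 rfl
  have hne' : ¬(r ≠ r ∧ i ≠ r) := fun h => h.1 rfl
  simp only [if_neg hne, if_neg hne', h0 i hir, hr]
  split_ifs
  · have hv := ellTheta_ratio_inv hp hq0 (div_ne_zero (hx r) (hx i)) m
    rw [inv_div] at hv
    rw [Nat.cast_zero, zero_sub, zero_add, mul_div_assoc, hv,
      show q * S⁻¹ * x i * x r = q * S⁻¹ * x r * x i by ring]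
    ring
  · rw [Nat.cast_zero, sub_zero, zpow_natCast, add_zero, one_mul, mul_div_assoc]

theorem wellPoisedFactor_single :
    wellPoisedFactor p q x (Pi.single r m) =
      ellTheta ((∏ k, x k) * x r * q ^ (m + m)) p / ellTheta ((∏ k, x k) * x r) p *
        ∏ i ∈ Finset.univ.erase r,
          ellTheta ((∏ k, x k) * x i * q ^ m) p / ellTheta ((∏ k, x k) * x i) p := by
  unfold wellPoisedFactor
  rw [sum_single, ← Finset.mul_prod_erase _ _ (Finset.mem_univ r), Pi.single_eq_same]
  congr 1
  refine Finset.prod_congr rfl fun i hi => ?_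
  rw [Pi.single_eq_of_ne (Finset.ne_of_mem_erase hi), zero_add]

theorem terminatingFactor_single :
    terminatingFactor p q x S N (Pi.single r m) =
      ellFac (q ^ (-(N r : ℤ)) * x r / x r) q p m
          * ellFac (q ^ (N r + 1) * S⁻¹ * x r * x r) q p m *
        ∏ i ∈ Finset.univ.erase r, (ellFac (q ^ (-(N i : ℤ)) * x r / x i) q p m
          * ellFac (q ^ (N i + 1) * S⁻¹ * x r * x i) q p m) := by
  unfold terminatingFactor
  rw [Finset.prod_eq_single r, Pi.single_eq_same,
    ← Finset.mul_prod_erase _ _ (Finset.mem_univ r)]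
  · intro i _ hi
    simp [Pi.single_eq_of_ne hi, ellFac_zero]
  · simp

theorem totalFactor_single :
    totalFactor p q x S N (Pi.single r m) =
      q ^ (((r : ℕ) + 1) * m) / (ellFac (q ^ (-(N r : ℤ)) * S * (∏ k, x k) / x r) q p m
          * ellFac (q ^ (N r + 1) * (∏ k, x k) * x r) q p m) *
        ∏ i ∈ Finset.univ.erase r, (ellFac (S * (∏ k, x k) / x i) q p m /
          (ellFac (q ^ (-(N i : ℤ)) * S * (∏ k, x k) / x i) q p m
            * ellFac (q ^ (N i + 1) * (∏ k, x k) * x i) q p m)) := by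
  unfold totalFactor
  rw [sum_single, ← Finset.mul_prod_erase _ _ (Finset.mem_univ r), Pi.single_eq_same, Nat.sub_self,
    ellFac_zero, one_mul]
  congr 1
  refine Finset.prod_congr rfl fun i hi => ?_
  rw [Pi.single_eq_of_ne (Finset.ne_of_mem_erase hi), mul_zero, pow_zero, mul_one, Nat.sub_zero]

theorem outerFactor_single (s : ℂ) :
    outerFactor p q x (Pi.single r m) s =
      ellFac ((∏ k, x k) * s) q p m / ellFac (q * x r / s) q p m := by
  unfold outerFactor
  have h : ∏ i, ellFac (q * x i / s) q p ((Pi.single r m : Fin n → ℕ) i) =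
      ellFac (q * x r / s) q p m := by
    rw [Finset.prod_eq_single r, Pi.single_eq_same]
    · intro i _ hi
      rw [Pi.single_eq_of_ne hi, ellFac_zero]
    · simp
  rw [sum_single, h]

theorem scaleParam_single_of_ne {i : Fin n} (hi : i ≠ r) :
    scaleParam q x (Pi.single r m) i = x i := by
  simp [scaleParam, Pi.single_eq_of_ne hi]

theorem scaleParam_single_same : scaleParam q x (Pi.single r m) r = q ^ m * x r := by
  simp [scaleParam]

theorem prod_scaleParam_single :
    ∏ k, scaleParam q x (Pi.single r m) k = q ^ m * ∏ k, x k := by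
  rw [prod_scaleParam, sum_single]

end Single

/-- Genericity of the parameters `x_i`, `b` and `K = a c`, where `S = x_1 ⋯ x_n b K`. -/
structure GenericParams {n : ℕ} (p q : ℂ) (x : Fin n → ℂ) (S b K : ℂ) : Prop where
  total : ∀ i, ThetaRegular p q ((∏ k, x k) * x i)
  quot : ∀ i j, i ≠ j → ThetaRegular p q (x i / x j)
  pair : ∀ i j, i ≠ j → ThetaRegular p q (x i * x j / S)
  outer : ∀ i, ThetaRegular p q (x i / b)
  inner : ∀ i j, ThetaRegular p q (x i * x j / K)
  dual : ∀ i, ThetaRegular p q (S * (∏ k, x k) / x i)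
  base : ∀ i, ThetaRegular p q (x i / ((∏ k, x k) * K))

/-- The prefactor extracted from the sum at a = q^m x_r, times the closed form of the shifted sum,
must be the cleared closed form. Both sides factor over the indices, and the identity holds index by
index. -/
theorem jacksonValue_shift {n : ℕ} {p q : ℂ} (hp : ‖p‖ < 1) (hq0 : q ≠ 0) {x : Fin n → ℂ}
    {S b c : ℂ} {N : Fin n → ℕ} {r : Fin n} {m : ℕ} (hm : m ≤ N r) (hx : ∀ i, x i ≠ 0)
    (hb : b ≠ 0) (hc : c ≠ 0) (hS : S = (∏ k, x k) * (q ^ m * x r) * b * c)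
    (G : GenericParams p q x S b (q ^ m * x r * c)) (hN : ellFac q q p (N r) ≠ 0) :
    coreFactor p q x S N (Pi.single r m) *
        (∏ j, outerFactor p q x (Pi.single r m) (x j)) *
        outerFactor p q x (Pi.single r m) b *
        (ellFac ((∏ k, x k) * (q ^ m * x r)) q p m * ellFac ((∏ k, x k) * c) q p m) *
        (∏ i, ellFac (q * scaleParam q x (Pi.single r m) i / (q ^ m * x r)) q p
            ((N - (Pi.single r m : Fin n → ℕ)) i) *
          ellFac (q * scaleParam q x (Pi.single r m) i / c) q p ((N - (Pi.single r m : Fin n → ℕ)) i)) *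
        jacksonValue p q (scaleParam q x (Pi.single r m)) S (N - (Pi.single r m : Fin n → ℕ)) (x r) b c =
      ∏ i, (ellFac (q * (∏ k, x k) * x i) q p (N i)
          / ellFac (q * S⁻¹ * (∏ k, x k)⁻¹ * x i) q p (N i)
        * ellFac (q * S⁻¹ * x i * (q ^ m * x r)) q p (N i)
        * (ellFac (q * S⁻¹ * x i * b) q p (N i) / ellFac (q * x i / b) q p (N i))
        * ellFac (q * S⁻¹ * x i * c) q p (N i)) := by
  have hqm : q ^ m ≠ 0 := pow_ne_zero _ hq0
  have hX : ∏ k, x k ≠ 0 := Finset.prod_ne_zero_iff.mpr fun i _ => hx i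
  have hS0 : S ≠ 0 := by
    rw [hS]
    exact mul_ne_zero (mul_ne_zero (mul_ne_zero hX (mul_ne_zero hqm (hx r))) hb) hc
  have hc' : ∀ (i : Fin n) (w : ℂ) (k : ℤ), w = q ^ k * x i / c → ∀ M, ellFac w q p M ≠ 0 := by
    intro i w k hw M
    refine (G.inner i r).ellFac_ne_zero hq0 (k + m) M ?_
    rw [hw, zpow_add₀ hq0, zpow_natCast]
    have := hx r
    field_simp
  have hNr : (N - (Pi.single r m : Fin n → ℕ)) r = N r - m := by simp
  have hNi : ∀ i, i ≠ r → (N - (Pi.single r m : Fin n → ℕ)) i = N i := fun i hi => by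
    simp [Pi.single_eq_of_ne hi]
  -- The weight q^{(r+1)m} of the summand and the q^{-rm} from the inverted pairs leave q^m, the
  -- amount the diagonal identity requires.
  have hpow : ((q ^ m)⁻¹) ^ (r : ℕ) * q ^ (((r : ℕ) + 1) * m) = q ^ m := by
    rw [add_mul, one_mul, pow_add, mul_comm (r : ℕ), pow_mul, inv_pow, ← mul_assoc,
      inv_mul_cancel₀ (pow_ne_zero _ hqm), one_mul]
  have hdiag := jacksonValue_shift_diag hp hq0 hpow hm (hx r) hX hb hc hS (G.total r) (G.dual r) hN
    (hc' r _ (1 + m) (by rw [zpow_add₀ hq0, zpow_one, zpow_natCast]; ring) _)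
  have hoff : ∀ i ∈ Finset.univ.erase r, _ := fun i hi =>
    jacksonValue_shift_offDiag (p := p) (X := ∏ k, x k) (S := S) (b := b) (c := c) hp hq0 m (N i)
      (hx r) (hx i) hX hS0 (G.total i) (G.quot r i (Finset.ne_of_mem_erase hi).symm)
      (G.pair r i (Finset.ne_of_mem_erase hi).symm) (G.dual i) (hc' i _ 1 (by rw [zpow_one]) _)
  have hA : (∏ i, ellFac (q * scaleParam q x (Pi.single r m) i / (q ^ m * x r)) q p
            ((N - (Pi.single r m : Fin n → ℕ)) i) *
          ellFac (q * scaleParam q x (Pi.single r m) i / c) q p ((N - (Pi.single r m : Fin n → ℕ)) i)) =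
      (ellFac (q * (q ^ m * x r) / (q ^ m * x r)) q p (N r - m)
          * ellFac (q * (q ^ m * x r) / c) q p (N r - m)) *
        ∏ i ∈ Finset.univ.erase r, (ellFac (q * x i / (q ^ m * x r)) q p (N i)
          * ellFac (q * x i / c) q p (N i)) := by
    rw [← Finset.mul_prod_erase _ _ (Finset.mem_univ r), hNr, scaleParam_single_same]
    congr 1
    refine Finset.prod_congr rfl fun i hi => ?_
    rw [hNi i (Finset.ne_of_mem_erase hi), scaleParam_single_of_ne (Finset.ne_of_mem_erase hi)]
  have hV : jacksonValue p q (scaleParam q x (Pi.single r m)) S (N - (Pi.single r m : Fin n → ℕ)) (x r) b c =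
      (ellFac (q * (q ^ m * ∏ k, x k) * (q ^ m * x r)) q p (N r - m)
          / ellFac (q * S⁻¹ * (q ^ m * ∏ k, x k)⁻¹ * (q ^ m * x r)) q p (N r - m)
        * (ellFac (q * S⁻¹ * (q ^ m * x r) * x r) q p (N r - m)
            / ellFac (q * (q ^ m * x r) / x r) q p (N r - m)
          * (ellFac (q * S⁻¹ * (q ^ m * x r) * b) q p (N r - m)
              / ellFac (q * (q ^ m * x r) / b) q p (N r - m))
          * (ellFac (q * S⁻¹ * (q ^ m * x r) * c) q p (N r - m)
              / ellFac (q * (q ^ m * x r) / c) q p (N r - m)))) *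
      ∏ i ∈ Finset.univ.erase r, (ellFac (q * (q ^ m * ∏ k, x k) * x i) q p (N i)
          / ellFac (q * S⁻¹ * (q ^ m * ∏ k, x k)⁻¹ * x i) q p (N i)
        * (ellFac (q * S⁻¹ * x i * x r) q p (N i) / ellFac (q * x i / x r) q p (N i)
          * (ellFac (q * S⁻¹ * x i * b) q p (N i) / ellFac (q * x i / b) q p (N i))
          * (ellFac (q * S⁻¹ * x i * c) q p (N i) / ellFac (q * x i / c) q p (N i)))) := by
    unfold jacksonValue
    rw [prod_scaleParam_single, ← Finset.mul_prod_erase _ _ (Finset.mem_univ r), hNr,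
      scaleParam_single_same]
    congr 1
    refine Finset.prod_congr rfl fun i hi => ?_
    rw [hNi i (Finset.ne_of_mem_erase hi), scaleParam_single_of_ne (Finset.ne_of_mem_erase hi)]
  have hO : ∏ j, outerFactor p q x (Pi.single r m) (x j) =
      ellFac ((∏ k, x k) * x r) q p m / ellFac (q * x r / x r) q p m *
        ∏ i ∈ Finset.univ.erase r,
          ellFac ((∏ k, x k) * x i) q p m / ellFac (q * x r / x i) q p m := by
    simp only [outerFactor_single]
    rw [← Finset.mul_prod_erase _ _ (Finset.mem_univ r)]
  conv_rhs =>
    rw [← Finset.mul_prod_erase _ _ (Finset.mem_univ r), ← hdiag, ← Finset.prod_congr rfl hoff]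
  rw [coreFactor, wellPoisedFactor_single,
    pairFactor_single hp hq0 hx (fun i j hij =>
      (G.quot i j hij.ne).ellTheta_ne_zero 0 (by rw [zpow_zero, one_mul])),
    terminatingFactor_single, totalFactor_single, hO, outerFactor_single, hA, hV]
  simp only [Finset.prod_mul_distrib]
  generalize ((q ^ m)⁻¹) ^ (r : ℕ) = w1
  generalize q ^ (((r : ℕ) + 1) * m) = w2
  ring

/-! ### Theta forms and admissible parameters -/

/-- `h`, as a function of `α`, is a form of degree `M` in `F₀ α` and `F₁ α`. -/
def IsThetaForm (F₀ F₁ : ℂ → ℂ) (M : ℕ) (h : ℂ → ℂ) : Prop :=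
  ∃ f : ℂ × ℂ → ℂ, IsBinaryForm M f ∧ ∀ α, α ≠ 0 → h α = f (F₀ α, F₁ α)

namespace IsThetaForm

variable {F₀ F₁ : ℂ → ℂ}

theorem mul {M M' : ℕ} {g h : ℂ → ℂ} (hg : IsThetaForm F₀ F₁ M g) (hh : IsThetaForm F₀ F₁ M' h) :
    IsThetaForm F₀ F₁ (M + M') fun α => g α * h α := by
  obtain ⟨f, hf, e⟩ := hg
  obtain ⟨f', hf', e'⟩ := hh
  exact ⟨_, hf.mul hf', fun α hα => by simp only [e α hα, e' α hα]⟩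

theorem const_mul {M : ℕ} {g : ℂ → ℂ} (c : ℂ) (hg : IsThetaForm F₀ F₁ M g) :
    IsThetaForm F₀ F₁ M fun α => c * g α := by
  obtain ⟨f, hf, e⟩ := hg
  exact ⟨_, hf.const_mul c, fun α hα => by simp only [e α hα]⟩

theorem add {M : ℕ} {g h : ℂ → ℂ} (hg : IsThetaForm F₀ F₁ M g) (hh : IsThetaForm F₀ F₁ M h) :
    IsThetaForm F₀ F₁ M fun α => g α + h α := by
  obtain ⟨f, hf, e⟩ := hg
  obtain ⟨f', hf', e'⟩ := hh
  exact ⟨_, hf.add hf', fun α hα => by simp only [e α hα, e' α hα]⟩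

theorem sum {ι : Type*} {M : ℕ} {g : ι → ℂ → ℂ} (s : Finset ι)
    (hg : ∀ i ∈ s, IsThetaForm F₀ F₁ M (g i)) : IsThetaForm F₀ F₁ M fun α => ∑ i ∈ s, g i α := by
  classical
  induction s using Finset.induction_on with
  | empty => exact ⟨_, IsBinaryForm.zero M, fun α _ => by simp⟩
  | insert a s ha ih =>
    simp only [Finset.sum_insert ha]
    exact (hg a (Finset.mem_insert_self a s)).add
      (ih fun i hi => hg i (Finset.mem_insert_of_mem hi))

theorem prod {ι : Type*} {M : ι → ℕ} {g : ι → ℂ → ℂ} (s : Finset ι)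
    (hg : ∀ i ∈ s, IsThetaForm F₀ F₁ (M i) (g i)) :
    IsThetaForm F₀ F₁ (∑ i ∈ s, M i) fun α => ∏ i ∈ s, g i α := by
  classical
  induction s using Finset.induction_on with
  | empty => exact ⟨_, IsBinaryForm.const 1, fun α _ => by simp⟩
  | insert a s ha ih =>
    simp only [Finset.sum_insert ha, Finset.prod_insert ha]
    exact (hg a (Finset.mem_insert_self a s)).mul
      (ih fun i hi => hg i (Finset.mem_insert_of_mem hi))

/-- By the addition formula each pair of factors with arguments proportional to α and 1/α is linear
in (F₀ α, F₁ α). This is why a and c move with their product fixed. -/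
theorem ellFac {p q w : ℂ}
    (hF : ∀ x y : ℂ, x ≠ 0 → y ≠ 0 →
      ellTheta (x * y) p * ellTheta (x / y) p = x * (F₁ x * F₀ y - F₀ x * F₁ y))
    (hq0 : q ≠ 0) (hw : w ≠ 0) (m : ℕ) :
    IsThetaForm F₀ F₁ m fun α => ellFac (w * α) q p m * ellFac (w / α) q p m := by
  have h := prod (F₀ := F₀) (F₁ := F₁) (M := fun _ => 1)
    (g := fun j α => ellTheta (w * q ^ j * α) p * ellTheta (w * q ^ j / α) p) (Finset.range m)
    fun j _ => ⟨_, IsBinaryForm.linear (w * q ^ j * F₁ (w * q ^ j)) (-(w * q ^ j * F₀ (w * q ^ j))),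
      fun α hα => by
        simp only [hF _ _ (mul_ne_zero hw (pow_ne_zero j hq0)) hα]
        ring⟩
  rw [Finset.sum_const, Finset.card_range, smul_eq_mul, mul_one] at h
  convert h using 2 with α
  rw [_root_.ellFac, _root_.ellFac, ← Finset.prod_mul_distrib]
  refine Finset.prod_congr rfl fun j _ => ?_
  rw [mul_right_comm, div_mul_eq_mul_div]

end IsThetaForm

/-- The parameters give non-vanishing denominators. -/
structure Admissible {n : ℕ} (p q : ℂ) (x : Fin n → ℂ) (S a b c : ℂ) (N : Fin n → ℕ) : Prop where
  total : ∀ i, ellTheta ((∏ k, x k) * x i) p ≠ 0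
  quot : ∀ i j, i < j → ellTheta (x i / x j) p ≠ 0
  pair : ∀ i j, i < j → ellFac (q * S⁻¹ * x i * x j) q p (N i + N j) ≠ 0
  inner : ∀ i j, ellFac (q * x i / x j) q p (N i) ≠ 0
  left : ∀ i, ellFac (q * x i / a) q p (N i) ≠ 0
  mid : ∀ i, ellFac (q * x i / b) q p (N i) ≠ 0
  right : ∀ i, ellFac (q * x i / c) q p (N i) ≠ 0
  dual : ∀ i, ellFac (q ^ (-(N i : ℤ)) * S * (∏ k, x k) / x i) q p (∑ k, N k) ≠ 0
  long : ∀ i, ellFac (q ^ (N i + 1) * (∏ k, x k) * x i) q p (∑ k, N k) ≠ 0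

/-- Separates the interpolation points q^k x_i with the same i, where genericity of the x_i gives
nothing. -/
theorem ellTheta_zpow_ne_zero {p q : ℂ} (hp : ‖p‖ < 1) (hq0 : q ≠ 0) {M : ℕ}
    (h : ellFac q q p M ≠ 0) {k : ℤ} (hk : k ≠ 0) (hk' : k.natAbs ≤ M) : ellTheta (q ^ k) p ≠ 0 := by
  have hpos : ∀ d : ℕ, d ≠ 0 → d ≤ M → ellTheta (q ^ d) p ≠ 0 := by
    intro d hd hdM
    have := (ellFac_ne_zero_iff.mp h) (d - 1) (by omega)
    rwa [← pow_succ', Nat.sub_add_cancel (Nat.one_le_iff_ne_zero.mpr hd)] at this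
  rcases Int.natAbs_eq k with hk1 | hk1
  · rw [hk1, zpow_natCast]
    exact hpos _ (Int.natAbs_ne_zero.mpr hk) hk'
  · rw [hk1, zpow_neg, zpow_natCast, ellTheta_inv hp (pow_ne_zero _ hq0)]
    exact mul_ne_zero (neg_ne_zero.mpr (inv_ne_zero (pow_ne_zero _ hq0)))
      (hpos _ (Int.natAbs_ne_zero.mpr hk) hk')

/-- Makes the induction hypothesis applicable. Genericity covers all denominators except those where
x_i cancels and a pure power of q remains; these are among the factors of (q)_{N_i}. -/
theorem GenericParams.admissible_shift {n : ℕ} {p q : ℂ} (hq0 : q ≠ 0)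
    {x : Fin n → ℂ} {S b c : ℂ} {N : Fin n → ℕ} {r : Fin n} {m : ℕ} (hm : m ≤ N r)
    (hx : ∀ i, x i ≠ 0) (G : GenericParams p q x S b (q ^ m * x r * c))
    (hN : ∀ i, ellFac q q p (N i) ≠ 0) :
    Admissible p q (scaleParam q x (Pi.single r m)) S (x r) b c
      (N - (Pi.single r m : Fin n → ℕ)) := by
  set μ : Fin n → ℕ := Pi.single r m with hμ
  have hμr : μ r = m := by simp [hμ]
  have hY : ∏ k, scaleParam q x μ k = q ^ m * ∏ k, x k := prod_scaleParam_single
  have hq : ∀ k : ℕ, q ^ k ≠ 0 := fun k => pow_ne_zero k hq0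
  refine ⟨fun i => ?_, fun i j hij => ?_, fun i j hij => ?_, fun i j => ?_, fun i => ?_, fun i => ?_,
    fun i => ?_, fun i => ?_, fun i => ?_⟩
  · refine (G.total i).ellTheta_ne_zero (m + μ i : ℕ) ?_
    rw [hY, scaleParam, zpow_natCast]
    ring
  · refine (G.quot i j hij.ne).ellTheta_ne_zero ((μ i : ℤ) - μ j) ?_
    rw [scaleParam, scaleParam, zpow_sub₀ hq0, zpow_natCast, zpow_natCast]
    field_simp
  · refine (G.pair i j hij.ne).ellFac_ne_zero hq0 (1 + μ i + μ j : ℕ) _ ?_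
    rw [scaleParam, scaleParam, zpow_natCast]
    ring
  · by_cases hij : i = j
    · subst hij
      have e : q * scaleParam q x μ i / scaleParam q x μ i = q := by
        have := hx i
        have := hq (μ i)
        rw [scaleParam]
        field_simp
      rw [e, ellFac_ne_zero_iff]
      intro k hk
      rw [Pi.sub_apply] at hk
      exact ellFac_ne_zero_iff.mp (hN i) k (by omega)
    · refine (G.quot i j hij).ellFac_ne_zero hq0 (1 + (μ i : ℤ) - μ j) _ ?_
      rw [scaleParam, scaleParam, zpow_sub₀ hq0, zpow_add₀ hq0, zpow_natCast, zpow_natCast,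
        zpow_one]
      field_simp
  · by_cases hir : i = r
    · subst hir
      rw [ellFac_ne_zero_iff]
      intro k hk
      rw [Pi.sub_apply, hμr] at hk
      have e : q * scaleParam q x μ i / x i * q ^ k = q * q ^ (m + k) := by
        have := hx i
        rw [scaleParam, hμr]
        field_simp
        ring
      rw [e]
      exact ellFac_ne_zero_iff.mp (hN i) (m + k) (by omega)
    · refine (G.quot i r hir).ellFac_ne_zero hq0 (1 + μ i : ℕ) _ ?_
      rw [scaleParam, zpow_natCast]
      ring
  · refine (G.outer i).ellFac_ne_zero hq0 (1 + μ i : ℕ) _ ?_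
    rw [scaleParam, zpow_natCast]
    ring
  · refine (G.inner i r).ellFac_ne_zero hq0 (1 + μ i + m : ℕ) _ ?_
    have := hx r
    have := hq m
    rw [scaleParam, zpow_natCast]
    field_simp
    ring
  · refine (G.dual i).ellFac_ne_zero hq0 (-((N - μ) i : ℤ) + m - μ i) _ ?_
    have := hq (μ i)
    rw [hY, scaleParam, zpow_sub₀ hq0, zpow_add₀ hq0, zpow_natCast, zpow_natCast]
    field_simp
  · refine (G.total i).ellFac_ne_zero hq0 ((N - μ) i + 1 + m + μ i : ℕ) _ ?_
    rw [hY, scaleParam, zpow_natCast]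
    ring

/-! ### The two sides as functions of a, and their values at the interpolation points -/

section Interpolation

variable {n : ℕ} (p q : ℂ) (x : Fin n → ℂ) (S b : ℂ) (N : Fin n → ℕ)

/-- The indices `0 ≤ λ_i ≤ N_i`. -/
def boxIndices (N : Fin n → ℕ) : Finset (Fin n → ℕ) :=
  Fintype.piFinset fun i => Finset.range (N i + 1)

theorem mem_boxIndices {N l : Fin n → ℕ} : l ∈ boxIndices N ↔ ∀ i, l i ≤ N i := by
  simp [boxIndices]

/-- The sum of `jacksonTerm`, multiplied by the denominators that involve `a` and `c`. -/
noncomputable def clearedSum (a c : ℂ) : ℂ :=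
  ∑ l ∈ boxIndices N, coreFactor p q x S N l * (∏ j, outerFactor p q x l (x j)) *
    outerFactor p q x l b * (clearedFactor p q x N l a * clearedFactor p q x N l c)

/-- The closed form of `clearedSum`. -/
noncomputable def clearedValue (a c : ℂ) : ℂ :=
  ∏ i, (ellFac (q * (∏ k, x k) * x i) q p (N i)
          / ellFac (q * S⁻¹ * (∏ k, x k)⁻¹ * x i) q p (N i)
        * ellFac (q * S⁻¹ * x i * a) q p (N i)
        * (ellFac (q * S⁻¹ * x i * b) q p (N i) / ellFac (q * x i / b) q p (N i))
        * ellFac (q * S⁻¹ * x i * c) q p (N i))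

variable {p q x S b N}

/-- The degree does not depend on λ: the numerators contribute |λ| and the cleared denominators the
sum of the N_i - λ_i. -/
theorem isThetaForm_clearedSum {F₀ F₁ : ℂ → ℂ}
    (hF : ∀ x y : ℂ, x ≠ 0 → y ≠ 0 →
      ellTheta (x * y) p * ellTheta (x / y) p = x * (F₁ x * F₀ y - F₀ x * F₁ y))
    (hq0 : q ≠ 0) (hx : ∀ i, x i ≠ 0) {κ : ℂ} (hκ : κ ≠ 0) :
    IsThetaForm F₀ F₁ (∑ i, N i) fun α => clearedSum p q x S b N (κ * α) (κ / α) := by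
  have hX : ∏ k, x k ≠ 0 := Finset.prod_ne_zero_iff.mpr fun i _ => hx i
  refine IsThetaForm.sum _ fun l hl => ?_
  rw [mem_boxIndices] at hl
  refine IsThetaForm.const_mul _ ?_
  have h1 := IsThetaForm.ellFac hF hq0 (mul_ne_zero hX hκ) (∑ k, l k)
  have h2 := IsThetaForm.prod Finset.univ fun i _ =>
    IsThetaForm.ellFac hF hq0 (div_ne_zero (mul_ne_zero (pow_ne_zero (l i + 1) hq0) (hx i)) hκ)
      (N i - l i)
  have h3 := h1.mul h2
  have hdeg : ∑ k, l k + ∑ i, (N i - l i) = ∑ i, N i := by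
    rw [← Finset.sum_add_distrib]
    exact Finset.sum_congr rfl fun i _ => Nat.add_sub_cancel' (hl i)
  rw [hdeg] at h3
  convert h3 using 2 with α
  unfold clearedFactor
  rw [Finset.prod_mul_distrib]
  have e1 : ∀ i, q ^ (l i + 1) * x i / (κ * α) = q ^ (l i + 1) * x i / κ / α := fun i => by
    rw [div_div]
  have e2 : ∀ i, q ^ (l i + 1) * x i / (κ / α) = q ^ (l i + 1) * x i / κ * α := fun i => by
    rw [div_div_eq_mul_div, mul_div_right_comm]
  simp only [e1, e2]
  rw [mul_assoc (∏ k, x k), mul_div_assoc (∏ k, x k)]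
  ring

theorem isThetaForm_clearedValue {F₀ F₁ : ℂ → ℂ}
    (hF : ∀ x y : ℂ, x ≠ 0 → y ≠ 0 →
      ellTheta (x * y) p * ellTheta (x / y) p = x * (F₁ x * F₀ y - F₀ x * F₁ y))
    (hq0 : q ≠ 0) (hx : ∀ i, x i ≠ 0) (hS : S ≠ 0) {κ : ℂ} (hκ : κ ≠ 0) :
    IsThetaForm F₀ F₁ (∑ i, N i) fun α => clearedValue p q x S b N (κ * α) (κ / α) := by
  refine IsThetaForm.prod _ fun i _ => ?_
  have h := (IsThetaForm.ellFac hF hq0 (mul_ne_zero (mul_ne_zero (mul_ne_zero hq0 (inv_ne_zero hS))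
    (hx i)) hκ) (N i)).const_mul (ellFac (q * (∏ k, x k) * x i) q p (N i)
          / ellFac (q * S⁻¹ * (∏ k, x k)⁻¹ * x i) q p (N i)
        * (ellFac (q * S⁻¹ * x i * b) q p (N i) / ellFac (q * x i / b) q p (N i)))
  convert h using 2 with α
  rw [mul_assoc (q * S⁻¹ * x i), mul_div_assoc (q * S⁻¹ * x i)]
  ring

theorem coreFactor_zero (h1 : ∀ i, ellTheta ((∏ k, x k) * x i) p ≠ 0)
    (h2 : ∀ i j, i < j → ellTheta (x i / x j) p ≠ 0) : coreFactor p q x S N 0 = 1 := by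
  have e1 : wellPoisedFactor p q x 0 = 1 := Finset.prod_eq_one fun i _ => by
    simp [div_self (h1 i)]
  have e2 : pairFactor p q x S 0 = 1 := Finset.prod_eq_one fun i _ =>
    Finset.prod_eq_one fun j hj => by
      simp [div_self (h2 i j (Finset.mem_Ioi.mp hj)), ellFac_zero]
  have e3 : terminatingFactor p q x S N 0 = 1 := by simp [terminatingFactor, ellFac_zero]
  have e4 : totalFactor p q x S N 0 = 1 := by simp [totalFactor, ellFac_zero]
  rw [coreFactor, e1, e2, e3, e4]
  norm_num

theorem outerFactor_zero (s : ℂ) : outerFactor p q x 0 s = 1 := by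
  simp [outerFactor, ellFac_zero]

/-- At a = 1/X the factor (Xa)_{|λ|} = (1)_{|λ|} contains θ(1) = 0 unless λ = 0. The single
remaining term matches the closed form because S = XbK. -/
theorem clearedSum_base (hp : ‖p‖ < 1) (hq0 : q ≠ 0) (hx : ∀ i, x i ≠ 0) {K : ℂ} (hb : b ≠ 0)
    (hK : K ≠ 0) (hS : S = (∏ k, x k) * b * K) (G : GenericParams p q x S b K) :
    clearedSum p q x S b N (∏ k, x k)⁻¹ (K * ∏ k, x k) =
      clearedValue p q x S b N (∏ k, x k)⁻¹ (K * ∏ k, x k) := by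
  have hX : ∏ k, x k ≠ 0 := Finset.prod_ne_zero_iff.mpr fun i _ => hx i
  unfold clearedSum clearedValue
  rw [Finset.sum_eq_single 0]
  · rw [coreFactor_zero (fun i => (G.total i).ellTheta_ne_zero 0 (by simp))
      (fun i j hij => (G.quot i j hij.ne).ellTheta_ne_zero 0 (by simp))]
    simp only [outerFactor_zero, Finset.prod_const_one, clearedFactor, Pi.zero_apply,
      Finset.sum_const_zero, ellFac_zero, one_mul, zero_add, pow_one, Nat.sub_zero]
    rw [← Finset.prod_mul_distrib]
    refine Finset.prod_congr rfl fun i _ => ?_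
    have n1 : ellFac (q * S⁻¹ * (∏ k, x k)⁻¹ * x i) q p (N i) ≠ 0 := by
      refine ((G.dual i).inv hp hq0 ?_).ellFac_ne_zero hq0 1 _ ?_
      · refine div_ne_zero (mul_ne_zero ?_ hX) (hx i)
        rw [hS]
        exact mul_ne_zero (mul_ne_zero hX hb) hK
      · rw [zpow_one, inv_div]
        ring
    have n2 : ellFac (q * x i / b) q p (N i) ≠ 0 :=
      (G.outer i).ellFac_ne_zero hq0 1 _ (by rw [zpow_one]; ring)
    have e1 : q * x i / (∏ k, x k)⁻¹ = q * (∏ k, x k) * x i := by field_simp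
    have e2 : q * x i / (K * ∏ k, x k) = q * S⁻¹ * x i * b := by
      rw [hS]
      field_simp
    have e3 : q * S⁻¹ * x i * (∏ k, x k)⁻¹ = q * S⁻¹ * (∏ k, x k)⁻¹ * x i := by ring
    have e4 : q * S⁻¹ * x i * (K * ∏ k, x k) = q * x i / b := by
      rw [hS]
      field_simp
    rw [e1, e2, e3, e4]
    rw [div_mul_cancel₀ _ n1, mul_assoc (ellFac (q * (∏ k, x k) * x i) q p (N i)),
      div_mul_cancel₀ _ n2]
  · intro l _ hl
    have hL : ∑ k, l k ≠ 0 := by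
      intro h0
      refine hl (funext fun i => ?_)
      exact (Finset.sum_eq_zero_iff.mp h0) i (Finset.mem_univ i)
    have : clearedFactor p q x N l (∏ k, x k)⁻¹ = 0 := by
      rw [clearedFactor, mul_inv_cancel₀ hX, ellFac_one_eq_zero hp q hL, zero_mul]
    rw [this, zero_mul, mul_zero]
  · intro h
    exact absurd (mem_boxIndices.mpr fun i => Nat.zero_le _) h

end Interpolation

section Step

variable {n : ℕ} {p q : ℂ} {x : Fin n → ℂ} {S b : ℂ} {N : Fin n → ℕ}

/-- At a = q^m x_r the cleared denominator of index r contains θ(1) = 0 when λ_r < m. The other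
terms have index l + μ, and the cocycle relations turn them into the summand of the shifted problem.
-/
theorem clearedSum_shift (hp : ‖p‖ < 1) (hq0 : q ≠ 0) (hx : ∀ i, x i ≠ 0) {c : ℂ} {r : Fin n}
    {m : ℕ} (hm : m ≤ N r) (hb : b ≠ 0) (hc : c ≠ 0)
    (hS : S = (∏ k, x k) * (q ^ m * x r) * b * c)
    (G : GenericParams p q x S b (q ^ m * x r * c)) (hN : ∀ i, ellFac q q p (N i) ≠ 0)
    (ih : ∑ l ∈ boxIndices (N - (Pi.single r m : Fin n → ℕ)),
        jacksonTerm p q (scaleParam q x (Pi.single r m)) S (N - (Pi.single r m : Fin n → ℕ)) l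
          (x r) b c =
      jacksonValue p q (scaleParam q x (Pi.single r m)) S (N - (Pi.single r m : Fin n → ℕ))
        (x r) b c) :
    clearedSum p q x S b N (q ^ m * x r) c = clearedValue p q x S b N (q ^ m * x r) c := by
  unfold clearedValue
  rw [← jacksonValue_shift hp hq0 hm hx hb hc hS G (hN r), ← ih, Finset.mul_sum]
  set μ : Fin n → ℕ := Pi.single r m with hμ
  have hμr : μ r = m := by simp [hμ]
  have hμN : ∀ i, μ i ≤ N i := fun i => by
    by_cases hir : i = r
    · rw [hir, hμr]
      exact hm
    · simp [hμ, Pi.single_eq_of_ne hir]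
  have hqm : q ^ m ≠ 0 := pow_ne_zero m hq0
  have A := G.admissible_shift hq0 hm hx hN
  rw [← hμ] at A
  have hsum : ∑ k, μ k = m := sum_single
  have hyr : scaleParam q x μ r = q ^ m * x r := scaleParam_single_same
  have hleft : ∀ i, ellFac (q * scaleParam q x μ i / (q ^ m * x r)) q p ((N - μ) i) ≠ 0 := by
    intro i
    rw [← hyr]
    exact A.inner i r
  -- The r-th scaled parameter is a = q^m x_r itself, so x_r and a trade places: the old x_r becomes
  -- the new a.
  have hO : ∀ l : Fin n → ℕ, (∏ j, outerFactor p q (scaleParam q x μ) l (x j)) *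
      outerFactor p q (scaleParam q x μ) l (q ^ m * x r) =
      (∏ j, outerFactor p q (scaleParam q x μ) l (scaleParam q x μ j)) *
        outerFactor p q (scaleParam q x μ) l (x r) := by
    intro l
    rw [← Finset.mul_prod_erase _ _ (Finset.mem_univ r),
      ← Finset.mul_prod_erase _ (fun j => outerFactor p q (scaleParam q x μ) l (scaleParam q x μ j))
        (Finset.mem_univ r), hyr]
    have : ∏ j ∈ Finset.univ.erase r, outerFactor p q (scaleParam q x μ) l (scaleParam q x μ j) =
        ∏ j ∈ Finset.univ.erase r, outerFactor p q (scaleParam q x μ) l (x j) :=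
      Finset.prod_congr rfl fun j hj => by
        rw [hμ, scaleParam_single_of_ne (Finset.ne_of_mem_erase hj)]
    rw [this]
    ring
  symm
  refine Finset.sum_of_injOn (fun l => l + μ) (fun l _ l' _ h => add_right_cancel h) ?_ ?_ ?_
  · intro l hl
    simp only [Finset.mem_coe, mem_boxIndices, Pi.sub_apply, Pi.add_apply] at hl ⊢
    intro i
    have := hl i
    have := hμN i
    omega
  · intro l hl hl'
    rw [mem_boxIndices] at hl
    have hlr : l r < m := by
      by_contra! hge
      refine hl' ⟨l - μ, ?_, ?_⟩
      · simp only [Finset.mem_coe, mem_boxIndices, Pi.sub_apply]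
        exact fun i => Nat.sub_le_sub_right (hl i) _
      · refine tsub_add_cancel_of_le fun i => ?_
        by_cases hir : i = r
        · rw [hir, hμr]
          exact hge
        · simp [hμ, Pi.single_eq_of_ne hir]
    have h0 : clearedFactor p q x N l (q ^ m * x r) = 0 := by
      unfold clearedFactor
      refine mul_eq_zero_of_right _ (Finset.prod_eq_zero (Finset.mem_univ r) ?_)
      refine Finset.prod_eq_zero (i := m - 1 - l r) (Finset.mem_range.mpr (by omega)) ?_
      have e : q ^ (l r + 1) * x r / (q ^ m * x r) * q ^ (m - 1 - l r) = 1 := by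
        have : q ^ (l r + 1) * q ^ (m - 1 - l r) = q ^ m := by
          rw [← pow_add]
          congr 1
          omega
        have := hx r
        rw [div_mul_eq_mul_div, div_eq_one_iff_eq (mul_ne_zero hqm this)]
        linear_combination x r * ‹q ^ (l r + 1) * q ^ (m - 1 - l r) = q ^ m›
      rw [e, ellTheta_one hp]
    rw [h0, zero_mul, mul_zero]
  · intro l hl
    rw [mem_boxIndices] at hl
    have hcore : coreFactor p q x S N (l + μ) =
        coreFactor p q x S N μ * coreFactor p q (scaleParam q x μ) S (N - μ) l :=
      coreFactor_add hq0 hμN A.total A.quot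
    have hcl : ∀ s, (∀ i, ellFac (q * scaleParam q x μ i / s) q p ((N - μ) i) ≠ 0) →
        clearedFactor p q x N (l + μ) s = ellFac ((∏ k, x k) * s) q p m *
          (outerFactor p q (scaleParam q x μ) l s *
            ∏ i, ellFac (q * scaleParam q x μ i / s) q p ((N - μ) i)) := fun s hs => by
      rw [clearedFactor_add, hsum, clearedFactor_eq hl hs]
    have hout : ∏ j, outerFactor p q x (l + μ) (x j) =
        (∏ j, outerFactor p q x μ (x j)) * ∏ j, outerFactor p q (scaleParam q x μ) l (x j) := by
      rw [← Finset.prod_mul_distrib]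
      exact Finset.prod_congr rfl fun j _ => outerFactor_add _
    rw [hcore, hcl _ hleft, hcl _ A.right, hout, outerFactor_add b, jacksonTerm,
      Finset.prod_mul_distrib]
    linear_combination (-(coreFactor p q x S N μ * (∏ j, outerFactor p q x μ (x j)) *
      outerFactor p q x μ b * (ellFac ((∏ k, x k) * (q ^ m * x r)) q p m *
      ellFac ((∏ k, x k) * c) q p m) *
      (∏ i, ellFac (q * scaleParam q x μ i / (q ^ m * x r)) q p ((N - μ) i)) *
      (∏ i, ellFac (q * scaleParam q x μ i / c) q p ((N - μ) i)) *
      coreFactor p q (scaleParam q x μ) S (N - μ) l * outerFactor p q (scaleParam q x μ) l b *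
      outerFactor p q (scaleParam q x μ) l c)) * hO l

end Step

/-! ### The induction step for generic parameters -/

/-- The summation formula, under the assumption that no denominator vanishes. -/
def JacksonSum {n : ℕ} (p q : ℂ) (N : Fin n → ℕ) : Prop :=
  ∀ (x : Fin n → ℂ) (S a b c : ℂ), (∀ i, x i ≠ 0) → a ≠ 0 → b ≠ 0 → c ≠ 0 →
    S = (∏ k, x k) * a * b * c → Admissible p q x S a b c N →
    ∑ l ∈ boxIndices N, jacksonTerm p q x S N l a b c = jacksonValue p q x S N a b c

theorem jacksonSum_generic {n : ℕ} {p q : ℂ} (hp : ‖p‖ < 1) (hq0 : q ≠ 0) {x : Fin n → ℂ}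
    {S a b c : ℂ} {N : Fin n → ℕ} (ih : ∀ N' : Fin n → ℕ, ∑ k, N' k < ∑ k, N k → JacksonSum p q N')
    (hx : ∀ i, x i ≠ 0) (ha : a ≠ 0) (hb : b ≠ 0) (hc : c ≠ 0)
    (hS : S = (∏ k, x k) * a * b * c) (A : Admissible p q x S a b c N)
    (G : GenericParams p q x S b (a * c)) :
    ∑ l ∈ boxIndices N, jacksonTerm p q x S N l a b c = jacksonValue p q x S N a b c := by
  have hX : ∏ k, x k ≠ 0 := Finset.prod_ne_zero_iff.mpr fun i _ => hx i
  have hq : ∀ k : ℕ, q ^ k ≠ 0 := fun k => pow_ne_zero k hq0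
  have hS0 : S ≠ 0 := by
    rw [hS]
    exact mul_ne_zero (mul_ne_zero (mul_ne_zero hX ha) hb) hc
  have hN : ∀ i, ellFac q q p (N i) ≠ 0 := fun i => by
    have := A.inner i i
    rwa [mul_div_cancel_right₀ _ (hx i)] at this
  set K := a * c with hK
  have hK0 : K ≠ 0 := mul_ne_zero ha hc
  -- A square root of K makes the line ac = K symmetric: a = κα, c = κ/α.
  obtain ⟨κ, hκ⟩ := IsAlgClosed.exists_pow_nat_eq K (n := 2) two_pos
  have hκ0 : κ ≠ 0 := by
    rintro rfl
    exact hK0 (by rw [← hκ]; simp)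
  have hSK : S = (∏ k, x k) * b * K := by
    rw [hS, hK]
    ring
  obtain ⟨F₀, F₁, hF⟩ := exists_ellTheta_mul_ellTheta_div hp
  have hform := (isThetaForm_clearedSum (S := S) (b := b) (N := N) hF hq0 hx hκ0).add
    ((isThetaForm_clearedValue (b := b) (N := N) hF hq0 hx hS0 hκ0).const_mul (-1))
  obtain ⟨f, hf, hfeq⟩ := hform
  beta_reduce at hfeq
  -- The index (i, k) with k < N_i stands for the point a = q^{k+1} x_i; the point a = 1/X is the
  -- extra one.
  have hcard : ∑ i, N i = Fintype.card (Σ i : Fin n, Fin (N i)) := by simp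
  rw [hcard] at hf
  let P : ℂ → ℂ × ℂ := fun α => (F₀ α, F₁ α)
  -- By the addition formula the determinant of the vectors at two points is, up to a nonzero
  -- factor, θ(αβ/K)θ(α/β).
  have hdet : ∀ α β : ℂ, α ≠ 0 → β ≠ 0 → ellTheta (α * β / K) p ≠ 0 → ellTheta (α / β) p ≠ 0 →
      (P (α / κ)).1 * (P (β / κ)).2 - (P (α / κ)).2 * (P (β / κ)).1 ≠ 0 := by
    intro α β hα hβ h1 h2 h0
    have h := hF (α / κ) (β / κ) (div_ne_zero hα hκ0) (div_ne_zero hβ hκ0)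
    rw [div_mul_div_comm, ← pow_two, hκ, div_div_div_cancel_right₀ hκ0] at h
    refine mul_ne_zero h1 h2 ?_
    rw [h]
    linear_combination (-(α / κ)) * h0
  have hzero : ∀ α, α ≠ 0 →
      clearedSum p q x S b N α (K / α) = clearedValue p q x S b N α (K / α) → f (P (α / κ)) = 0 := by
    intro α hα h
    have e := hfeq (α / κ) (div_ne_zero hα hκ0)
    have e1 : κ * (α / κ) = α := by field_simp
    have e2 : κ / (α / κ) = K / α := by
      rw [← hκ]
      field_simp
    rw [e1, e2, h] at e
    rw [← e]
    ring
  have hpt : ∀ (m : ℕ) (i : Fin n), q ^ m * x i ≠ 0 := fun m i => mul_ne_zero (hq m) (hx i)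
  have hvanish : ∀ Q, f Q = 0 := by
    refine hf.eq_zero (P ((∏ k, x k)⁻¹ / κ))
      (fun u => P (q ^ ((u.2 : ℕ) + 1) * x u.1 / κ)) ?_ ?_ ?_ ?_
    · rintro ⟨i, k⟩
      refine hdet _ _ (inv_ne_zero hX) (hpt _ _) ?_ ?_
      · refine (G.base i).ellTheta_ne_zero ((k : ℕ) + 1 : ℕ) ?_
        rw [zpow_natCast]
        field_simp
      · refine ((G.total i).inv hp hq0 (mul_ne_zero hX (hx i))).ellTheta_ne_zero
          (-((k : ℕ) + 1 : ℕ)) ?_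
        rw [zpow_neg, zpow_natCast]
        have := hpt ((k : ℕ) + 1) i
        field_simp
    · rintro ⟨i, k⟩ ⟨j, l⟩ hne
      refine hdet _ _ (hpt _ _) (hpt _ _) ?_ ?_
      · refine (G.inner i j).ellTheta_ne_zero ((k : ℕ) + 1 + (l + 1) : ℕ) ?_
        rw [zpow_natCast]
        ring
      · by_cases hij : i = j
        · subst hij
          have hkl : (k : ℕ) ≠ l := fun h => hne (by rw [Fin.ext h])
          have e : q ^ ((k : ℕ) + 1) * x i / (q ^ ((l : ℕ) + 1) * x i) = q ^ ((k : ℤ) - l) := by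
            have := hx i
            rw [zpow_sub₀ hq0, zpow_natCast, zpow_natCast, pow_succ, pow_succ]
            field_simp
          dsimp only
          rw [e]
          have := k.2
          have := l.2
          exact ellTheta_zpow_ne_zero hp hq0 (hN i) (by omega) (by omega)
        · refine (G.quot i j hij).ellTheta_ne_zero ((k : ℤ) - l) ?_
          have := hx j
          rw [zpow_sub₀ hq0, zpow_natCast, zpow_natCast, pow_succ, pow_succ]
          field_simp
    · refine hzero _ (inv_ne_zero hX) ?_
      rw [div_inv_eq_mul]
      exact clearedSum_base hp hq0 hx hb hK0 hSK G
    · rintro ⟨i, k⟩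
      have hm : (k : ℕ) + 1 ≤ N i := k.2
      have hc' : K / (q ^ ((k : ℕ) + 1) * x i) ≠ 0 := div_ne_zero hK0 (hpt _ _)
      have hKc : q ^ ((k : ℕ) + 1) * x i * (K / (q ^ ((k : ℕ) + 1) * x i)) = K :=
        mul_div_cancel₀ _ (hpt _ _)
      have G' := G
      rw [← hKc] at G'
      have hS' : S = (∏ k, x k) * (q ^ ((k : ℕ) + 1) * x i) * b *
          (K / (q ^ ((k : ℕ) + 1) * x i)) := by
        rw [hSK]
        linear_combination (-((∏ k, x k) * b)) * hKc
      refine hzero _ (hpt _ _) (clearedSum_shift hp hq0 hx hm hb hc' hS' G' hN ?_)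
      refine ih _ ?_ _ _ _ _ _ ?_ (hx i) hb hc' ?_ (G'.admissible_shift hq0 hm hx hN)
      · refine Finset.sum_lt_sum (fun j _ => Nat.sub_le _ _) ⟨i, Finset.mem_univ i, ?_⟩
        simp only [Pi.sub_apply, Pi.single_eq_same]
        omega
      · exact fun j => mul_ne_zero (hq _) (hx j)
      · rw [prod_scaleParam_single, hS']
        ring
  have hfinal : clearedSum p q x S b N a c = clearedValue p q x S b N a c := by
    have e := hfeq (a / κ) (div_ne_zero ha hκ0)
    have e1 : κ * (a / κ) = a := by field_simp
    have e2 : κ / (a / κ) = c := by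
      rw [div_div_eq_mul_div, ← pow_two, hκ, hK, mul_div_cancel_left₀ _ ha]
    rw [hvanish, e1, e2] at e
    linear_combination e
  have hDa : ∏ i, ellFac (q * x i / a) q p (N i) ≠ 0 :=
    Finset.prod_ne_zero_iff.mpr fun i _ => A.left i
  have hDc : ∏ i, ellFac (q * x i / c) q p (N i) ≠ 0 :=
    Finset.prod_ne_zero_iff.mpr fun i _ => A.right i
  refine mul_right_cancel₀ (mul_ne_zero hDa hDc) ?_
  have h1 : (∑ l ∈ boxIndices N, jacksonTerm p q x S N l a b c) *
      ((∏ i, ellFac (q * x i / a) q p (N i)) * ∏ i, ellFac (q * x i / c) q p (N i)) =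
      clearedSum p q x S b N a c := by
    rw [clearedSum, Finset.sum_mul]
    refine Finset.sum_congr rfl fun l hl => ?_
    rw [mem_boxIndices] at hl
    rw [clearedFactor_eq hl A.left, clearedFactor_eq hl A.right, jacksonTerm]
    ring
  have h2 : jacksonValue p q x S N a b c *
      ((∏ i, ellFac (q * x i / a) q p (N i)) * ∏ i, ellFac (q * x i / c) q p (N i)) =
      clearedValue p q x S b N a c := by
    rw [jacksonValue, clearedValue, ← Finset.prod_mul_distrib, ← Finset.prod_mul_distrib]
    refine Finset.prod_congr rfl fun i _ => ?_
    have na := A.left i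
    have nc := A.right i
    generalize ellFac (q * x i / a) q p (N i) = B at *
    generalize ellFac (q * x i / c) q p (N i) = C at *
    generalize ellFac (q * x i / b) q p (N i) = D
    generalize ellFac (q * S⁻¹ * (∏ k, x k)⁻¹ * x i) q p (N i) = E
    have hBC : B⁻¹ * B * (C⁻¹ * C) = 1 := by
      rw [inv_mul_cancel₀ na, inv_mul_cancel₀ nc, one_mul]
    refine Eq.trans ?_ ((congrArg (HMul.hMul _) hBC).trans (mul_one _))
    ring_nf
  rw [h1, h2, hfinal]

/-! ### Removing genericity by deformation -/

/-- `u` is continuous and does not vanish at `t₀`. -/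
def ContNonzeroAt (u : ℝ → ℂ) (t₀ : ℝ) : Prop := ContinuousAt u t₀ ∧ u t₀ ≠ 0

namespace ContNonzeroAt

variable {t₀ : ℝ} {u v : ℝ → ℂ}

theorem const {z : ℂ} (hz : z ≠ 0) : ContNonzeroAt (fun _ => z) t₀ := ⟨continuousAt_const, hz⟩

theorem mul (hu : ContNonzeroAt u t₀) (hv : ContNonzeroAt v t₀) :
    ContNonzeroAt (fun t => u t * v t) t₀ := ⟨hu.1.mul hv.1, mul_ne_zero hu.2 hv.2⟩

theorem inv (hu : ContNonzeroAt u t₀) : ContNonzeroAt (fun t => (u t)⁻¹) t₀ :=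
  ⟨hu.1.inv₀ hu.2, inv_ne_zero hu.2⟩

theorem div (hu : ContNonzeroAt u t₀) (hv : ContNonzeroAt v t₀) :
    ContNonzeroAt (fun t => u t / v t) t₀ := ⟨hu.1.div hv.1 hv.2, div_ne_zero hu.2 hv.2⟩

theorem prod {ι : Type*} (s : Finset ι) {f : ι → ℝ → ℂ} (h : ∀ i ∈ s, ContNonzeroAt (f i) t₀) :
    ContNonzeroAt (fun t => ∏ i ∈ s, f i t) t₀ :=
  ⟨tendsto_finsetProd s fun i hi => (h i hi).1, Finset.prod_ne_zero_iff.mpr fun i hi => (h i hi).2⟩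

theorem ellTheta {p : ℂ} (hp : ‖p‖ < 1) (hu : ContNonzeroAt u t₀) :
    ContinuousAt (fun t => ellTheta (u t) p) t₀ :=
  (continuousAt_ellTheta hp hu.2).comp (f := u) hu.1

theorem ellFac {p q : ℂ} (hp : ‖p‖ < 1) (hq0 : q ≠ 0) (hu : ContNonzeroAt u t₀) (m : ℕ) :
    ContinuousAt (fun t => ellFac (u t) q p m) t₀ :=
  tendsto_finsetProd _ fun _ _ => (hu.mul (const (pow_ne_zero _ hq0))).ellTheta hp

end ContNonzeroAt

theorem ellFac_ne_zero_of_le {u q p : ℂ} {m M : ℕ} (hm : m ≤ M) (h : ellFac u q p M ≠ 0) :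
    ellFac u q p m ≠ 0 := by
  rw [ellFac_ne_zero_iff] at h ⊢
  exact fun j hj => h j (hj.trans_le hm)

/-- The k-th argument is the inverse of the argument numbered N_i - 1 - k in the denominator
(q^{-N_i}SX/x_i)_{|N|} of the summand, so this denominator of the closed form needs no separate
assumption. -/
theorem Admissible.value_ne_zero {n : ℕ} {p q : ℂ} (hp : ‖p‖ < 1) (hq0 : q ≠ 0) {x : Fin n → ℂ}
    {S a b c : ℂ} {N : Fin n → ℕ} (hx : ∀ i, x i ≠ 0) (hS : S ≠ 0)
    (A : Admissible p q x S a b c N) (i : Fin n) :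
    ellFac (q * S⁻¹ * (∏ k, x k)⁻¹ * x i) q p (N i) ≠ 0 := by
  have hX : ∏ k, x k ≠ 0 := Finset.prod_ne_zero_iff.mpr fun i _ => hx i
  have hNi : N i ≤ ∑ k, N k := Finset.single_le_sum (fun _ _ => Nat.zero_le _) (Finset.mem_univ i)
  rw [ellFac_ne_zero_iff]
  intro k hk
  have h := ellFac_ne_zero_iff.mp (A.dual i) (N i - 1 - k) (by omega)
  have hz : q * S⁻¹ * (∏ k, x k)⁻¹ * x i * q ^ k ≠ 0 :=
    mul_ne_zero (mul_ne_zero (mul_ne_zero (mul_ne_zero hq0 (inv_ne_zero hS)) (inv_ne_zero hX))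
      (hx i)) (pow_ne_zero _ hq0)
  have e : q ^ (-(N i : ℤ)) * S * (∏ k, x k) / x i * q ^ (N i - 1 - k) =
      (q * S⁻¹ * (∏ k, x k)⁻¹ * x i * q ^ k)⁻¹ := by
    obtain ⟨d, hd⟩ := Nat.exists_eq_add_of_lt hk
    have hd' : N i - 1 - k = d := by omega
    have := hx i
    rw [hd', hd, zpow_neg, zpow_natCast, pow_add, pow_add, pow_one]
    field_simp
  rw [e, ellTheta_inv hp hz] at h
  exact right_ne_zero_of_mul h

section Continuity

variable {n : ℕ} {p q : ℂ} {x : ℝ → Fin n → ℂ} {S a b c : ℝ → ℂ} {N l : Fin n → ℕ} {t₀ : ℝ}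

theorem continuousAt_outerFactor (hp : ‖p‖ < 1) (hq0 : q ≠ 0)
    (hx : ∀ i, ContNonzeroAt (fun t => x t i) t₀) {s : ℝ → ℂ} (hs : ContNonzeroAt s t₀)
    (hl : ∀ i, l i ≤ N i) (h : ∀ i, ellFac (q * x t₀ i / s t₀) q p (N i) ≠ 0) :
    ContinuousAt (fun t => outerFactor p q (x t) l (s t)) t₀ := by
  have hX : ContNonzeroAt (fun t => ∏ k, x t k) t₀ := ContNonzeroAt.prod _ fun k _ => hx k
  refine ((hX.mul hs).ellFac hp hq0 _).div (tendsto_finsetProd _ fun i _ =>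
    (((ContNonzeroAt.const hq0).mul (hx i)).div hs).ellFac hp hq0 _) ?_
  exact Finset.prod_ne_zero_iff.mpr fun i _ => ellFac_ne_zero_of_le (hl i) (h i)

theorem continuousAt_coreFactor (hp : ‖p‖ < 1) (hq0 : q ≠ 0)
    (hx : ∀ i, ContNonzeroAt (fun t => x t i) t₀) (hS : ContNonzeroAt S t₀)
    (hl : ∀ i, l i ≤ N i) (A : Admissible p q (x t₀) (S t₀) (a t₀) (b t₀) (c t₀) N) :
    ContinuousAt (fun t => coreFactor p q (x t) (S t) N l) t₀ := by
  have hX : ContNonzeroAt (fun t => ∏ k, x t k) t₀ := ContNonzeroAt.prod _ fun k _ => hx k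
  have hc : ∀ k : ℕ, ContNonzeroAt (fun _ => q ^ k) t₀ := fun k =>
    ContNonzeroAt.const (pow_ne_zero k hq0)
  have hz : ∀ k : ℤ, ContNonzeroAt (fun _ => q ^ k) t₀ := fun k =>
    ContNonzeroAt.const (zpow_ne_zero k hq0)
  have hq : ContNonzeroAt (fun _ => q) t₀ := ContNonzeroAt.const hq0
  have hL : ∑ k, l k ≤ ∑ k, N k := Finset.sum_le_sum fun i _ => hl i
  refine ContinuousAt.mul (ContinuousAt.mul (ContinuousAt.mul ?_ ?_) ?_) ?_
  · exact tendsto_finsetProd _ fun i _ =>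
      (((hX.mul (hx i)).mul (hc _)).ellTheta hp).div ((hX.mul (hx i)).ellTheta hp) (A.total i)
  · exact tendsto_finsetProd _ fun i _ => tendsto_finsetProd _ fun j hj =>
      (((((hz _).mul (hx i)).div (hx j)).ellTheta hp).div (((hx i).div (hx j)).ellTheta hp)
        (A.quot i j (Finset.mem_Ioi.mp hj))).mul
      (continuousAt_const.div ((((hq.mul hS.inv).mul (hx i)).mul (hx j)).ellFac hp hq0 _)
        (ellFac_ne_zero_of_le (add_le_add (hl i) (hl j)) (A.pair i j (Finset.mem_Ioi.mp hj))))
  · exact tendsto_finsetProd _ fun i _ => tendsto_finsetProd _ fun j _ =>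
      ((((hz _).mul (hx i)).div (hx j)).ellFac hp hq0 _).mul
        (((((hc _).mul hS.inv).mul (hx i)).mul (hx j)).ellFac hp hq0 _)
  · exact tendsto_finsetProd _ fun i _ =>
      ((((hS.mul hX).div (hx i)).ellFac hp hq0 _).mul continuousAt_const).div
      ((((((hz _).mul hS).mul hX).div (hx i)).ellFac hp hq0 _).mul
        ((((hc _).mul hX).mul (hx i)).ellFac hp hq0 _))
      (mul_ne_zero (ellFac_ne_zero_of_le hL (A.dual i)) (ellFac_ne_zero_of_le hL (A.long i)))

theorem continuousAt_jacksonTerm (hp : ‖p‖ < 1) (hq0 : q ≠ 0)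
    (hx : ∀ i, ContNonzeroAt (fun t => x t i) t₀) (hS : ContNonzeroAt S t₀)
    (ha : ContNonzeroAt a t₀) (hb : ContNonzeroAt b t₀) (hc : ContNonzeroAt c t₀)
    (hl : ∀ i, l i ≤ N i) (A : Admissible p q (x t₀) (S t₀) (a t₀) (b t₀) (c t₀) N) :
    ContinuousAt (fun t => jacksonTerm p q (x t) (S t) N l (a t) (b t) (c t)) t₀ :=
  ((((continuousAt_coreFactor hp hq0 hx hS hl A).mul (tendsto_finsetProd _ fun j _ =>
    continuousAt_outerFactor hp hq0 hx (hx j) hl fun i => A.inner i j)).mul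
    (continuousAt_outerFactor hp hq0 hx ha hl A.left)).mul
    (continuousAt_outerFactor hp hq0 hx hb hl A.mid)).mul
    (continuousAt_outerFactor hp hq0 hx hc hl A.right)

theorem continuousAt_jacksonValue (hp : ‖p‖ < 1) (hq0 : q ≠ 0)
    (hx : ∀ i, ContNonzeroAt (fun t => x t i) t₀) (hS : ContNonzeroAt S t₀)
    (ha : ContNonzeroAt a t₀) (hb : ContNonzeroAt b t₀) (hc : ContNonzeroAt c t₀)
    (A : Admissible p q (x t₀) (S t₀) (a t₀) (b t₀) (c t₀) N) :
    ContinuousAt (fun t => jacksonValue p q (x t) (S t) N (a t) (b t) (c t)) t₀ := by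
  have hX : ContNonzeroAt (fun t => ∏ k, x t k) t₀ := ContNonzeroAt.prod _ fun k _ => hx k
  have hq : ContNonzeroAt (fun _ => q) t₀ := ContNonzeroAt.const hq0
  have hs : ∀ {s : ℝ → ℂ} (_ : ContNonzeroAt s t₀) (i : Fin n)
      (_ : ellFac (q * x t₀ i / s t₀) q p (N i) ≠ 0),
      ContinuousAt (fun t => ellFac (q * (S t)⁻¹ * x t i * s t) q p (N i) /
        ellFac (q * x t i / s t) q p (N i)) t₀ := fun hs i h =>
    ((((hq.mul hS.inv).mul (hx i)).mul hs).ellFac hp hq0 _).div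
      (((hq.mul (hx i)).div hs).ellFac hp hq0 _) h
  exact tendsto_finsetProd _ fun i _ =>
    ((((hq.mul hX).mul (hx i)).ellFac hp hq0 _).div
      ((((hq.mul hS.inv).mul hX.inv).mul (hx i)).ellFac hp hq0 _)
      (A.value_ne_zero hp hq0 (fun i => (hx i).2) hS.2 i)).mul
    (((hs ha i (A.left i)).mul (hs hb i (A.mid i))).mul (hs hc i (A.right i)))

theorem eventually_admissible (hp : ‖p‖ < 1) (hq0 : q ≠ 0)
    (hx : ∀ i, ContNonzeroAt (fun t => x t i) t₀) (hS : ContNonzeroAt S t₀)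
    (ha : ContNonzeroAt a t₀) (hb : ContNonzeroAt b t₀) (hc : ContNonzeroAt c t₀)
    (A : Admissible p q (x t₀) (S t₀) (a t₀) (b t₀) (c t₀) N) :
    ∀ᶠ t in 𝓝 t₀, Admissible p q (x t) (S t) (a t) (b t) (c t) N := by
  have hX : ContNonzeroAt (fun t => ∏ k, x t k) t₀ := ContNonzeroAt.prod _ fun k _ => hx k
  have hq : ContNonzeroAt (fun _ => q) t₀ := ContNonzeroAt.const hq0
  have hcn : ∀ k : ℕ, ContNonzeroAt (fun _ => q ^ k) t₀ := fun k =>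
    ContNonzeroAt.const (pow_ne_zero k hq0)
  have hz : ∀ k : ℤ, ContNonzeroAt (fun _ => q ^ k) t₀ := fun k =>
    ContNonzeroAt.const (zpow_ne_zero k hq0)
  have h1 : ∀ᶠ t in 𝓝 t₀, ∀ i, ellTheta ((∏ k, x t k) * x t i) p ≠ 0 :=
    eventually_all.mpr fun i => ((hX.mul (hx i)).ellTheta hp).eventually_ne (A.total i)
  have h2 : ∀ᶠ t in 𝓝 t₀, ∀ i j, i < j → ellTheta (x t i / x t j) p ≠ 0 :=
    eventually_all.mpr fun i => eventually_all.mpr fun j => eventually_imp_distrib_left.mpr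
      fun hij => (((hx i).div (hx j)).ellTheta hp).eventually_ne (A.quot i j hij)
  have h3 : ∀ᶠ t in 𝓝 t₀, ∀ i j, i < j →
      ellFac (q * (S t)⁻¹ * x t i * x t j) q p (N i + N j) ≠ 0 :=
    eventually_all.mpr fun i => eventually_all.mpr fun j => eventually_imp_distrib_left.mpr
      fun hij => ((((hq.mul hS.inv).mul (hx i)).mul (hx j)).ellFac hp hq0 _).eventually_ne
        (A.pair i j hij)
  have hs : ∀ {s : ℝ → ℂ} (_ : ContNonzeroAt s t₀)
      (_ : ∀ i, ellFac (q * x t₀ i / s t₀) q p (N i) ≠ 0),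
      ∀ᶠ t in 𝓝 t₀, ∀ i, ellFac (q * x t i / s t) q p (N i) ≠ 0 := fun hs h =>
    eventually_all.mpr fun i =>
      (((hq.mul (hx i)).div hs).ellFac hp hq0 _).eventually_ne (h i)
  have h4 : ∀ᶠ t in 𝓝 t₀, ∀ j i, ellFac (q * x t i / x t j) q p (N i) ≠ 0 :=
    eventually_all.mpr fun j => hs (hx j) fun i => A.inner i j
  have h5 : ∀ᶠ t in 𝓝 t₀, ∀ i,
      ellFac (q ^ (-(N i : ℤ)) * S t * (∏ k, x t k) / x t i) q p (∑ k, N k) ≠ 0 :=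
    eventually_all.mpr fun i =>
      (((((hz _).mul hS).mul hX).div (hx i)).ellFac hp hq0 _).eventually_ne (A.dual i)
  have h6 : ∀ᶠ t in 𝓝 t₀, ∀ i,
      ellFac (q ^ (N i + 1) * (∏ k, x t k) * x t i) q p (∑ k, N k) ≠ 0 :=
    eventually_all.mpr fun i =>
      ((((hcn _).mul hX).mul (hx i)).ellFac hp hq0 _).eventually_ne (A.long i)
  filter_upwards [h1, h2, h3, h4, hs ha A.left, hs hb A.mid, hs hc A.right, h5, h6]
    with t k1 k2 k3 k4 k5 k6 k7 k8 k9
  exact ⟨k1, k2, k3, fun i j => k4 j i, k5, k6, k7, k8, k9⟩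

end Continuity

/-- For each k the map from real t to q^k z e^{dt} is injective, so it meets the countable zero set
for countably many t; then take the union over k. -/
theorem eventually_thetaRegular {p q : ℂ} (hp : ‖p‖ < 1) (hq0 : q ≠ 0) {z : ℂ} (hz : z ≠ 0) {d : ℤ}
    (hd : d ≠ 0) : ∀ᶠ t : ℝ in cocountable, ThetaRegular p q (z * Complex.exp t ^ d) := by
  have : CountableInterFilter (cocountable : Filter ℝ) :=
    CardinalInterFilter.toCountableInterFilter _ Cardinal.aleph0_lt_aleph_one
  refine eventually_countable_forall.mpr fun k => mem_cocountable.mpr ?_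
  have hne : q ^ k * z ≠ 0 := mul_ne_zero (zpow_ne_zero k hq0) hz
  have hinj : Function.Injective fun t : ℝ => q ^ k * (z * Complex.exp t ^ d) := by
    intro t t' h
    have h1 : Complex.exp t ^ d = Complex.exp t' ^ d := by
      refine mul_left_cancel₀ hne ?_
      rw [mul_assoc, mul_assoc]
      exact h
    rw [← Complex.exp_int_mul, ← Complex.exp_int_mul, ← Complex.ofReal_intCast,
      ← Complex.ofReal_mul, ← Complex.ofReal_mul, ← Complex.ofReal_exp, ← Complex.ofReal_exp,
      Complex.ofReal_inj, Real.exp_eq_exp] at h1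
    exact mul_left_cancel₀ (Int.cast_ne_zero.mpr hd) h1
  refine ((countable_ellTheta_zero hp).preimage hinj).mono fun t ht => ?_
  refine ⟨mul_ne_zero (zpow_ne_zero k hq0) (mul_ne_zero hz (zpow_ne_zero d (Complex.exp_ne_zero _))),
    ?_⟩
  simpa using ht

/-- Cocountable subsets of ℝ are dense, so t can tend to t₀ through generic values. -/
instance neBot_nhds_inf_cocountable (t₀ : ℝ) : (𝓝 t₀ ⊓ cocountable).NeBot := by
  rw [inf_neBot_iff]
  intro s hs s' hs'
  rw [mem_cocountable] at hs'
  have hd : Dense s' := by simpa using hs'.dense_compl ℝ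
  exact (mem_closure_iff_nhds.mp (hd t₀)) s hs

/-- A one-parameter deformation of given parameters is generic outside a countable set. -/
theorem eventually_genericParams {n : ℕ} {p q : ℂ} (hp : ‖p‖ < 1) (hq0 : q ≠ 0) {x : Fin n → ℂ}
    {a b c : ℂ} (hx : ∀ i, x i ≠ 0) (ha : a ≠ 0) (hb : b ≠ 0) (hc : c ≠ 0) :
    ∀ᶠ t : ℝ in cocountable, GenericParams p q (fun i => x i * Complex.exp t ^ ((i : ℕ) + 1))
      ((∏ k, x k * Complex.exp t ^ ((k : ℕ) + 1)) * (a * Complex.exp t ^ (2 * n + 1)) *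
        (b * Complex.exp t ^ (n + 1)) * c)
      (b * Complex.exp t ^ (n + 1)) (a * Complex.exp t ^ (2 * n + 1) * c) := by
  have hX : ∏ k, x k ≠ 0 := Finset.prod_ne_zero_iff.mpr fun i _ => hx i
  set X := ∏ k, x k with hXdef
  set ω : ℕ := ∑ k : Fin n, ((k : ℕ) + 1) with hω
  have hprod : ∀ w : ℂ, ∏ k : Fin n, x k * w ^ ((k : ℕ) + 1) = X * w ^ ω := fun w => by
    rw [Finset.prod_mul_distrib, Finset.prod_pow_eq_pow_sum]
  have key : ∀ {z : ℂ}, z ≠ 0 → ∀ {d : ℤ}, d ≠ 0 →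
      ∀ᶠ t : ℝ in cocountable, ThetaRegular p q (z * Complex.exp t ^ d) := fun hz _ hd =>
    eventually_thetaRegular hp hq0 hz hd
  have hS : X * a * b * c ≠ 0 := mul_ne_zero (mul_ne_zero (mul_ne_zero hX ha) hb) hc
  have hlt : ∀ i : Fin n, (i : ℕ) < n := fun i => i.2
  -- The weights i + 1 for the i-th x counted from 0, 2n + 1 for a, n + 1 for b and 0 for c give
  -- each quantity below a nonzero exponent of e^t. For instance x_i x_j has weight at most 2n, less
  -- than the weight of ac.
  have g1 := eventually_all.mpr fun i : Fin n =>
    key (mul_ne_zero hX (hx i)) (d := (ω + i + 1 : ℕ)) (by omega)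
  have g2 := eventually_all.mpr fun i : Fin n => eventually_all.mpr
    fun j : Fin n => eventually_imp_distrib_left.mpr fun hij : i ≠ j =>
      key (div_ne_zero (hx i) (hx j)) (d := (i : ℤ) - (j : ℤ)) (by
        have := Fin.val_ne_of_ne hij
        omega)
  have g3 := eventually_all.mpr fun i : Fin n => eventually_all.mpr
    fun j : Fin n =>
      key (div_ne_zero (mul_ne_zero (hx i) (hx j)) hS)
        (d := ((i + j + 2 : ℕ) : ℤ) - (ω + (2 * n + 1) + (n + 1) : ℕ)) (by
          have := hlt i
          have := hlt j
          omega)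
  have g4 := eventually_all.mpr fun i : Fin n =>
    key (div_ne_zero (hx i) hb) (d := ((i + 1 : ℕ) : ℤ) - (n + 1 : ℕ)) (by
      have := hlt i
      omega)
  have g5 := eventually_all.mpr fun i : Fin n => eventually_all.mpr
    fun j : Fin n =>
      key (div_ne_zero (mul_ne_zero (hx i) (hx j)) (mul_ne_zero ha hc))
        (d := ((i + j + 2 : ℕ) : ℤ) - (2 * n + 1 : ℕ)) (by
          have := hlt i
          have := hlt j
          omega)
  have g6 := eventually_all.mpr fun i : Fin n =>
    key (div_ne_zero (mul_ne_zero hS hX) (hx i))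
      (d := ((ω + (2 * n + 1) + (n + 1) + ω : ℕ) : ℤ) - (i + 1 : ℕ)) (by
        have := hlt i
        omega)
  have g7 := eventually_all.mpr fun i : Fin n =>
    key (div_ne_zero (hx i) (mul_ne_zero hX (mul_ne_zero ha hc)))
      (d := ((i + 1 : ℕ) : ℤ) - (ω + (2 * n + 1) : ℕ)) (by
        have := hlt i
        omega)
  filter_upwards [g1, g2, g3, g4, g5, g6, g7] with t h1 h2 h3 h4 h5 h6 h7
  have hw : Complex.exp t ≠ 0 := Complex.exp_ne_zero _
  set w := Complex.exp t
  have hwk : ∀ k : ℕ, w ^ k ≠ 0 := fun k => pow_ne_zero k hw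
  refine ⟨fun i => ?_, fun i j hij => ?_, fun i j _ => ?_, fun i => ?_, fun i j => ?_, fun i => ?_,
    fun i => ?_⟩
  · simp only [hprod]
    convert h1 i using 1
    rw [zpow_natCast]
    ring
  · convert h2 i j hij using 1
    rw [zpow_sub₀ hw, zpow_natCast, zpow_natCast, pow_succ, pow_succ]
    field_simp
  · simp only [hprod]
    convert h3 i j using 1
    rw [zpow_sub₀ hw, zpow_natCast, zpow_natCast]
    field_simp
    ring
  · convert h4 i using 1
    rw [zpow_sub₀ hw, zpow_natCast, zpow_natCast]
    field_simp
  · convert h5 i j using 1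
    rw [zpow_sub₀ hw, zpow_natCast, zpow_natCast]
    field_simp
    ring
  · simp only [hprod]
    convert h6 i using 1
    rw [zpow_sub₀ hw, zpow_natCast, zpow_natCast]
    have := hx i
    field_simp
    ring
  · simp only [hprod]
    convert h7 i using 1
    rw [zpow_sub₀ hw, zpow_natCast, zpow_natCast, pow_add w ω]
    field_simp

/-- Strong induction on |N|. Admissibility is an open condition along the deformation, so the
generic case applies for t near 0 outside a countable set, and uniqueness of limits gives t = 0. -/
theorem jacksonSum {n : ℕ} {p q : ℂ} (hp : ‖p‖ < 1) (hq0 : q ≠ 0) (N : Fin n → ℕ) :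
    JacksonSum p q N := by
  induction hM : ∑ k, N k using Nat.strong_induction_on generalizing N with
  | _ M ih =>
  intro x S a b c hx ha hb hc hS A
  let xt : ℝ → Fin n → ℂ := fun t i => x i * Complex.exp t ^ ((i : ℕ) + 1)
  let at' : ℝ → ℂ := fun t => a * Complex.exp t ^ (2 * n + 1)
  let bt : ℝ → ℂ := fun t => b * Complex.exp t ^ (n + 1)
  let St : ℝ → ℂ := fun t => (∏ k, xt t k) * at' t * bt t * c
  have hw : ContNonzeroAt (fun t : ℝ => Complex.exp t) 0 :=
    ⟨by fun_prop, Complex.exp_ne_zero _⟩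
  have hwk : ∀ k : ℕ, ContNonzeroAt (fun t : ℝ => Complex.exp t ^ k) 0 := fun k =>
    ⟨hw.1.pow k, pow_ne_zero k hw.2⟩
  have hxt : ∀ i, ContNonzeroAt (fun t => xt t i) 0 := fun i =>
    (ContNonzeroAt.const (hx i)).mul (hwk _)
  have hat : ContNonzeroAt at' 0 := (ContNonzeroAt.const ha).mul (hwk _)
  have hbt : ContNonzeroAt bt 0 := (ContNonzeroAt.const hb).mul (hwk _)
  have hct : ContNonzeroAt (fun _ => c) 0 := ContNonzeroAt.const hc
  have hSt : ContNonzeroAt St 0 :=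
    (((ContNonzeroAt.prod _ fun k _ => hxt k).mul hat).mul hbt).mul hct
  have x0 : xt 0 = x := by
    funext i
    simp [xt]
  have a0 : at' 0 = a := by simp [at']
  have b0 : bt 0 = b := by simp [bt]
  have S0 : St 0 = S := by
    simp only [St, x0, a0, b0]
    exact hS.symm
  have A0 : Admissible p q (xt 0) (St 0) (at' 0) (bt 0) c N := by
    rw [x0, a0, b0, S0]
    exact A
  have hL : Tendsto (fun t => ∑ l ∈ boxIndices N,
      jacksonTerm p q (xt t) (St t) N l (at' t) (bt t) c) (𝓝 0 ⊓ cocountable)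
      (𝓝 (∑ l ∈ boxIndices N, jacksonTerm p q x S N l a b c)) := by
    have h : ContinuousAt (fun t => ∑ l ∈ boxIndices N,
        jacksonTerm p q (xt t) (St t) N l (at' t) (bt t) c) 0 :=
      tendsto_finsetSum _ fun l hl =>
        continuousAt_jacksonTerm hp hq0 hxt hSt hat hbt hct (mem_boxIndices.mp hl) A0
    have h' := h.tendsto.mono_left (inf_le_left (b := cocountable))
    rwa [x0, a0, b0, S0] at h'
  have hR : Tendsto (fun t => jacksonValue p q (xt t) (St t) N (at' t) (bt t) c)
      (𝓝 0 ⊓ cocountable) (𝓝 (jacksonValue p q x S N a b c)) := by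
    have h' := (continuousAt_jacksonValue hp hq0 hxt hSt hat hbt hct A0).tendsto.mono_left
      (inf_le_left (b := cocountable))
    rwa [x0, a0, b0, S0] at h'
  refine tendsto_nhds_unique_of_eventuallyEq hL hR ?_
  have e1 : ∀ᶠ t in 𝓝 0 ⊓ cocountable, Admissible p q (xt t) (St t) (at' t) (bt t) c N :=
    (eventually_admissible hp hq0 hxt hSt hat hbt hct A0).filter_mono inf_le_left
  have e2 : ∀ᶠ t : ℝ in 𝓝 0 ⊓ cocountable, GenericParams p q (xt t) (St t) (bt t) (at' t * c) :=
    (eventually_genericParams hp hq0 hx ha hb hc).filter_mono inf_le_right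
  filter_upwards [e1, e2] with t At Gt
  have hwt : ∀ k : ℕ, Complex.exp t ^ k ≠ 0 := fun k => pow_ne_zero k (Complex.exp_ne_zero _)
  exact jacksonSum_generic hp hq0 (fun N' hN' => ih _ (hM ▸ hN') N' rfl)
    (fun i => mul_ne_zero (hx i) (hwt _)) (mul_ne_zero ha (hwt _)) (mul_ne_zero hb (hwt _)) hc rfl
    At Gt

/-! ### Translation to the original parameters -/

theorem prodAll_eq {n : ℕ} (s : Fin (n + 3) → ℂ) :
    prodAll s = (∏ i : Fin n, s (Fin.castAdd 3 i)) * s (Fin.natAdd n 0) * s (Fin.natAdd n 1) *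
      s (Fin.natAdd n 2) := by
  rw [prodAll, Fin.prod_univ_add, Fin.prod_univ_three]
  ring

theorem sumTerm_eq_jacksonTerm {n : ℕ} (p q : ℂ) (s : Fin (n + 3) → ℂ) (N l : Fin n → ℕ) :
    sumTerm p q s N l = jacksonTerm p q (fun i => s (Fin.castAdd 3 i)) (prodAll s) N l
      (s (Fin.natAdd n 0)) (s (Fin.natAdd n 1)) (s (Fin.natAdd n 2)) := by
  unfold sumTerm jacksonTerm coreFactor wellPoisedFactor pairFactor terminatingFactor totalFactor
    outerFactor prodFirst
  dsimp only
  rw [Fin.prod_univ_add (fun j : Fin (n + 3) => ellFac _ q p _ / _), Fin.prod_univ_three]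
  ring

theorem sumValue_eq_jacksonValue {n : ℕ} (p q : ℂ) (s : Fin (n + 3) → ℂ) (N : Fin n → ℕ) :
    sumValue p q s N = jacksonValue p q (fun i => s (Fin.castAdd 3 i)) (prodAll s) N
      (s (Fin.natAdd n 0)) (s (Fin.natAdd n 1)) (s (Fin.natAdd n 2)) := by
  unfold sumValue jacksonValue prodFirst
  simp only [Fin.prod_univ_three]

theorem theorem4p6 (n : ℕ) (p q : ℂ) (hp : ‖p‖ < 1) (hq0 : q ≠ 0) (hq : ‖q‖ < 1)
    (s : Fin (n + 3) → ℂ) (hs : ∀ j, s j ≠ 0) (N : Fin n → ℕ)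
    (h1 : ∀ i : Fin n, ellTheta (prodFirst s * s (Fin.castAdd 3 i)) p ≠ 0)
    (h2 : ∀ i j : Fin n, i < j →
      ellTheta (s (Fin.castAdd 3 i) / s (Fin.castAdd 3 j)) p ≠ 0)
    (h3 : ∀ i j : Fin n, i < j →
      ellFac (q * (prodAll s)⁻¹ * s (Fin.castAdd 3 i) * s (Fin.castAdd 3 j)) q p
        (N i + N j) ≠ 0)
    (h4 : ∀ (i : Fin n) (j : Fin (n + 3)),
      ellFac (q * s (Fin.castAdd 3 i) / s j) q p (N i) ≠ 0)
    (h5 : ∀ i : Fin n,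
      ellFac (q ^ (-(N i : ℤ)) * prodAll s * prodFirst s / s (Fin.castAdd 3 i)) q p
        (∑ k, N k) ≠ 0)
    (h6 : ∀ i : Fin n,
      ellFac (q ^ (N i + 1) * prodFirst s * s (Fin.castAdd 3 i)) q p (∑ k, N k) ≠ 0) :
    ∑ l ∈ Fintype.piFinset (fun i : Fin n => Finset.range (N i + 1)), sumTerm p q s N l
      = sumValue p q s N := by
  simp only [sumTerm_eq_jacksonTerm, sumValue_eq_jacksonValue]
  exact jacksonSum hp hq0 N _ _ _ _ _ (fun i => hs _) (hs _) (hs _) (hs _) (prodAll_eq s)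
    ⟨h1, h2, h3, fun i j => h4 i _, fun i => h4 i _, fun i => h4 i _, fun i => h4 i _, h5, h6⟩
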